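/- Let $M=\{m_{ij} : i,j\in\mathbb{Z}_3\}$, with the six contexts $C_i^{\mathrm{hor}}=\{m_{ij}: j\in\mathbb{Z}_3\}$ and $C_j^{\mathrm{ver}}=\{m_{ij}: i\in\mathbb{Z}_3\}$ forming the set $\mathcal{C}$. For $\beta:\mathcal{C}\to\mathbb{Z}_2$ the Mermin polytope $\mathrm{MP}_\beta$ is the set of families $p=(p_C)_{C\in\mathcal{C}}$ of probability distributions $p_C$ on $\mathbb{Z}_2^C$ such that $p_C$ and $p_{C'}$ have the same marginal on $\mathbb{Z}_2^{C\cap C'}$ for all $C,C'\in\mathcal{C}$, and such that every $p_C$ is supported in $O_\beta(C)=\{s:C\to\mathbb{Z}_2 : \sum_{m\in C}s(m)=\beta(C)\}$. For $m\in M$ let $p_m^0$ be the probability of the outcome $0$ for $m$, computed in any context containing $m$. Write $\mathrm{MP}_0=\mathrm{MP}_{\beta_0}$ with $\beta_0=0$, and $\mathrm{MP}_1=\mathrm{MP}_{\beta_1}$ with $\beta_1=0$ on the horizontal and $\beta_1=1$ on the vertical contexts. A subset $\Omega\subseteq M$ is closed if every context containing two distinct elements of $\Omega$ is contained in $\Omega$.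 A function $s:\Omega\to\mathbb{Z}_2$ is an outcome assignment (with respect to $\beta$) if $s|_C\in O_\beta(C)$ for every context $C\subseteq\Omega$. A closed set that admits an outcome assignment is called closed noncontextual (cnc), and a maximal cnc set is one that is maximal under inclusion. A subset $\Omega\subseteq M$ is of type 1 if it consists of three elements no two of which lie in a common context, and of type 2 if it is the union of two distinct contexts that intersect in a single element. A function $s:M\to\mathbb{Z}_2$ is called a homomorphism if $s(c)=s(a)+s(b)$ for every context $\{a,b,c\}$. **Theorem.** (i) There is a bijection between the homomorphisms $s:M\to\mathbb{Z}_2$ and the vertices of $\mathrm{MP}_0$. The vertex $p$ corresponding to $s$ is the deterministic one, i.e. each $p_C$ is the point mass at $s|_C$, and it is the unique point of $\mathrm{MP}_0$ with $p_m^0=\frac{1+(-1)^{s(m)}}{2}$ for all $m\in M$. Restriction is a bijection from the homomorphisms $s:M\to\mathbb{Z}_2$ to the functions $\{m_{00},m_{01},m_{10},m_{11}\}\to\mathbb{Z}_2$. In particular, $\mathrm{MP}_0$ has exactly $16$ vertices. (ii) With respect to $\beta_1$, the maximal cnc sets are exactly the subsets of type 1 and the subsets of type 2. There is a bijection between the pairs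 $(\Omega,s)$, where $\Omega\subseteq M$ is a maximal cnc set and $s:\Omega\to\mathbb{Z}_2$ is an outcome assignment, and the vertices of $\mathrm{MP}_1$. The vertex $p$ corresponding to $(\Omega,s)$ is the unique point of $\mathrm{MP}_1$ with $$p_m^0=\frac{1+(-1)^{s(m)}}{2}\ \text{ for } m\in\Omega,\qquad p_m^0=\frac12\ \text{ for } m\notin\Omega.$$ There are exactly $48$ vertices with $\Omega$ of type 1 and exactly $72$ vertices with $\Omega$ of type 2. -/

import Mathlib

namespace Mermin

/-- A measurement scenario on the measurement set `M` with outcome set `ℤ₂`: a collection of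
subsets of `M`, the contexts, labelled without repetition by `ι`, that covers `M`. -/
structure Scenario (M ι : Type) [DecidableEq M] where
  context : ι → Finset M
  context_injective : Function.Injective context
  cover : ∀ m : M, ∃ c : ι, m ∈ context c

section General

variable {M ι : Type} [DecidableEq M]

/-- The ambient real vector space of families `(p_C)` of functions `p_C : ℤ₂^C → ℝ`. -/
abbrev Scenario.Family (S : Scenario M ι) : Type :=
  (c : ι) → (S.context c → ZMod 2) → ℝ

/-- The restriction of a function `q : ℤ₂^C → ℝ` to `U ⊆ C`, that is, its marginal on `ℤ₂^U`. -/
def marginal {C U : Finset M} (h : U ⊆ C) (q : (C → ZMod 2) → ℝ) (t : U → ZMod 2) : ℝ :=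
  ∑ s : C → ZMod 2 with Finset.restrict₂ (π := fun _ => ZMod 2) h s = t, q s

/-- The nonsignaling polytope: families of probability distributions on the contexts whose
marginals on the intersections agree. -/
def Scenario.NS (S : Scenario M ι) : Set S.Family :=
  {p | (∀ c s, 0 ≤ p c s) ∧ (∀ c, ∑ s, p c s = 1) ∧
    ∀ c c', marginal (U := S.context c ∩ S.context c') Finset.inter_subset_left (p c) =
      marginal (U := S.context c ∩ S.context c') Finset.inter_subset_right (p c')}

/-- `O_β(C)`: the outcome assignments on the context `C`. -/
def Scenario.O (S : Scenario M ι) (β : ι → ZMod 2) (c : ι) : Set (S.context c → ZMod 2) :=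
  {s | ∑ m, s m = β c}

/-- The nonsignaling families such that every `p_C` is supported in `O_β(C)`. -/
def Scenario.NSβ (S : Scenario M ι) (β : ι → ZMod 2) : Set S.Family :=
  {p | p ∈ S.NS ∧ ∀ c, Function.support (p c) ⊆ S.O β c}

/-- `p_m^0` computed in the context `C ∋ m`: the probability of the outcome `0` for `m`. -/
def Scenario.probZero (S : Scenario M ι) (p : S.Family) (c : ι) (m : S.context c) : ℝ :=
  ∑ s : S.context c → ZMod 2 with s m = 0, p c s

/-- `Ω` is closed (under inference): a context that meets `Ω` in two distinct measurements is
contained in `Ω`. -/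
def Scenario.IsClosed (S : Scenario M ι) (Ω : Finset M) : Prop :=
  ∀ c, ∀ a ∈ S.context c ∩ Ω, ∀ b ∈ S.context c ∩ Ω, a ≠ b → S.context c ⊆ Ω

/-- `s : Ω → ℤ₂` is an outcome assignment: it restricts to an outcome assignment on every context
contained in `Ω`. -/
def Scenario.IsOutcomeAssignment (S : Scenario M ι) (β : ι → ZMod 2) (Ω : Finset M)
    (s : Ω → ZMod 2) : Prop :=
  ∀ (c : ι) (h : S.context c ⊆ Ω), Finset.restrict₂ (π := fun _ => ZMod 2) h s ∈ S.O β c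

/-- Closed noncontextual sets. -/
def Scenario.IsCnc (S : Scenario M ι) (β : ι → ZMod 2) (Ω : Finset M) : Prop :=
  S.IsClosed Ω ∧ ∃ s : Ω → ZMod 2, S.IsOutcomeAssignment β Ω s

/-- Pairs `(Ω, s)` of a maximal (for inclusion) closed noncontextual set `Ω` and an outcome
assignment `s` on `Ω`. -/
abbrev Scenario.CncPair (S : Scenario M ι) (β : ι → ZMod 2) : Type :=
  {x : (Ω : Finset M) × (Ω → ZMod 2) //
    Maximal (S.IsCnc β) x.1 ∧ S.IsOutcomeAssignment β x.1 x.2}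

/-- Type 1: three measurements, no two of which lie in a common context. -/
def Scenario.IsType1 (S : Scenario M ι) (Ω : Finset M) : Prop :=
  Ω.card = 3 ∧ ∀ a ∈ Ω, ∀ b ∈ Ω, a ≠ b → ∀ c, ¬ (a ∈ S.context c ∧ b ∈ S.context c)

/-- Type 2: the union of two distinct contexts that intersect in a single measurement. -/
def Scenario.IsType2 (S : Scenario M ι) (Ω : Finset M) : Prop :=
  ∃ c c' m, c ≠ c' ∧ S.context c ∩ S.context c' = {m} ∧ Ω = S.context c ∪ S.context c'

/-- The marginals prescribed by `s : Ω → ℤ₂`: `p_m^0 = (1 + (-1)^{s(m)}) / 2` for `m ∈ Ω` and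
`p_m^0 = 1/2` for `m ∉ Ω`. -/
def Scenario.HasMarginals (S : Scenario M ι) (p : S.Family) (Ω : Finset M)
    (s : Ω → ZMod 2) : Prop :=
  ∀ (c : ι) (m : S.context c), S.probZero p c m =
    if h : (m : M) ∈ Ω then (1 + (-1 : ℝ) ^ (s ⟨m, h⟩).val) / 2 else 1 / 2

end General

/-- The nine measurements `m_{ij}`. -/
abbrev Meas : Type := Fin 3 × Fin 3

/-- Labels of the six contexts: `inl i` is the horizontal one `C_i`, `inr j` the vertical one. -/
abbrev Ctx : Type := Fin 3 ⊕ Fin 3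

/-- The Mermin scenario. -/
def square : Scenario Meas Ctx where
  context := Sum.elim (fun i => Finset.univ.image fun j => (i, j))
    (fun j => Finset.univ.image fun i => (i, j))
  context_injective := by decide
  cover := by decide

/-- The Mermin polytope for `β`. -/
def MP (β : Ctx → ZMod 2) : Set square.Family := square.NSβ β

/-- The vertices of the Mermin polytope. -/
def vertices (β : Ctx → ZMod 2) : Set square.Family := (MP β).extremePoints ℝ

/-- `β₀ = 0` on all contexts. -/
def β₀ : Ctx → ZMod 2 := fun _ => 0

/-- `β₁` is `0` on the horizontal and `1` on the vertical contexts. -/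
def β₁ : Ctx → ZMod 2 := Sum.elim (fun _ => 0) (fun _ => 1)

/-- Group homomorphisms `M → ℤ₂`, where the sum of two distinct measurements of a context is the
third one: `s(c) = s(a) + s(b)` for every context `{a, b, c}`. -/
def IsHom (s : Meas → ZMod 2) : Prop :=
  ∀ C a b c, square.context C = {a, b, c} → s c = s a + s b

/-- `{m₀₀, m₀₁, m₁₀, m₁₁}`. -/
def corner : Finset Meas := {(0, 0), (0, 1), (1, 0), (1, 1)}

end Mermin

/-!
In terms of the expectation values `u m = 2 * p_m^0 - 1` the Mermin polytope is cut out of `ℝ⁹` by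
the inequalities `0 ≤ 1 + ∑ m ∈ C, (-1) ^ s m * u m` with `s ∈ O_β(C)`. At a vertex `u` the set `Ω`
of the measurements with `|u m| = 1` is closed, and a context not contained in `Ω` contributes at
most one to the rank of the tight inequalities modulo the coordinates in `Ω`. As this rank is nine,
`Ω` is everything or one of the sets of type 1 or 2, which meet every context and have a connected
complement. Hence `|u|` is constant off `Ω`, and unless it vanishes the signs of `u` are a global
outcome assignment, which extends the signs on `Ω`.

If such an extension `t` exists, then `u` lies strictly between the deterministic points of `t` and
of `t` flipped off `Ω`, and is not a vertex. Otherwise `u` vanishes off `Ω` and is determined by its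
signs on `Ω`. Every measurement lies in two contexts, so `∑ C, β C = 0` is necessary for a global
outcome assignment. It is also sufficient, and then assignments on `Ω` always extend, by counting.
-/

namespace Mermin

/-! ### Signs -/

/-- The sign character `z ↦ (-1) ^ z` of `ℤ₂`, which turns outcomes into expectation values. -/
noncomputable def sgn : AddChar (ZMod 2) ℝ :=
  AddChar.zmodChar 2 (by norm_num : (-1 : ℝ) ^ 2 = 1)

theorem sgn_apply (z : ZMod 2) : sgn z = (-1 : ℝ) ^ z.val :=
  AddChar.zmodChar_apply _ z

theorem sgn_one : sgn 1 = -1 := by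
  simp [sgn_apply, ZMod.val_one]

theorem eq_zero_or_one (z : ZMod 2) : z = 0 ∨ z = 1 := by
  revert z; decide

theorem sum_zmod_two {A : Type*} [AddCommMonoid A] (f : ZMod 2 → A) :
    ∑ z, f z = f 0 + f 1 :=
  Fin.sum_univ_two f

theorem abs_sgn (z : ZMod 2) : |sgn z| = 1 := by
  simp [sgn_apply, abs_pow]

theorem sgn_mul_self (z : ZMod 2) : sgn z * sgn z = 1 := by
  rw [← AddChar.map_add_eq_mul, CharTwo.add_self_eq_zero, AddChar.map_zero_eq_one]

theorem sgn_add_one (z : ZMod 2) : sgn (z + 1) = -sgn z := by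
  rw [AddChar.map_add_eq_mul, sgn_one, mul_neg_one]

theorem sgn_injective : Function.Injective sgn := by
  intro z w
  obtain rfl | rfl := eq_zero_or_one z <;> obtain rfl | rfl := eq_zero_or_one w <;>
    norm_num [sgn_one]

theorem neg_one_le_sgn_mul {x : ℝ} (hx : |x| ≤ 1) (z : ZMod 2) : -1 ≤ sgn z * x := by
  have : |sgn z * x| ≤ 1 := by rwa [abs_mul, abs_sgn, one_mul]
  exact (abs_le.1 this).1

/-- The outcome whose sign is the sign of `x`; the junk value at `x = 0` is `0`. -/
noncomputable def signOf (x : ℝ) : ZMod 2 := if 0 ≤ x then 0 else 1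

theorem abs_mul_sgn_signOf (x : ℝ) : |x| * sgn (signOf x) = x := by
  rw [signOf]
  split_ifs with h
  · simp [abs_of_nonneg h]
  · simp [abs_of_neg (not_le.1 h), sgn_one]

theorem sgn_signOf {x : ℝ} (hx : |x| = 1) : sgn (signOf x) = x := by
  simpa [hx] using abs_mul_sgn_signOf x

theorem signOf_sgn (z : ZMod 2) : signOf (sgn z) = z :=
  sgn_injective (sgn_signOf (abs_sgn z))

/-! ### Three-element types -/

/-- `a`, `b`, `c` enumerate their type without repetition. -/
structure IsTriple {α : Type*} (a b c : α) : Prop where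
  ne₁₂ : a ≠ b
  ne₁₃ : a ≠ c
  ne₂₃ : b ≠ c
  eq_or_eq_or_eq (x : α) : x = a ∨ x = b ∨ x = c

section Triple

variable {α β : Type*} {a b c : α}

theorem IsTriple.rotate (h : IsTriple a b c) : IsTriple b c a :=
  ⟨h.ne₂₃, h.ne₁₂.symm, h.ne₁₃.symm, fun x => by have := h.eq_or_eq_or_eq x; tauto⟩

theorem IsTriple.swap (h : IsTriple a b c) : IsTriple b a c :=
  ⟨h.ne₁₂.symm, h.ne₂₃, h.ne₁₃, fun x => by have := h.eq_or_eq_or_eq x; tauto⟩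

theorem IsTriple.univ_eq [Fintype α] [DecidableEq α] (h : IsTriple a b c) :
    (Finset.univ : Finset α) = {a, b, c} := by
  ext x
  simpa using h.eq_or_eq_or_eq x

theorem exists_isTriple_of_ne [Fintype α] (hα : Fintype.card α = 3) (hab : a ≠ b) :
    ∃ c, IsTriple a b c := by
  classical
  obtain ⟨c, hc⟩ := Finset.card_eq_one.1
    (show ((Finset.univ.erase a).erase b).card = 1 by
      rw [Finset.card_erase_of_mem (by simp [hab.symm]), Finset.card_erase_of_mem (by simp),
        Finset.card_univ, hα])
  have hmem (x : α) : x ≠ b ∧ x ≠ a ↔ x = c := by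
    simpa using congrArg (x ∈ ·) hc
  obtain ⟨hcb, hca⟩ := (hmem c).2 rfl
  exact ⟨c, hab, hca.symm, hcb.symm, fun x => by have := hmem x; tauto⟩

theorem exists_isTriple [Fintype α] (hα : Fintype.card α = 3) (a : α) :
    ∃ b c, IsTriple a b c := by
  have : Nontrivial α := Fintype.one_lt_card_iff_nontrivial.1 (by omega)
  obtain ⟨b, hb⟩ := exists_ne a
  exact ⟨b, exists_isTriple_of_ne hα hb.symm⟩

theorem IsTriple.sum_eq [Fintype α] {A : Type*} [AddCommMonoid A] (h : IsTriple a b c)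
    (f : α → A) : ∑ x, f x = f a + f b + f c := by
  classical
  rw [h.univ_eq, Finset.sum_insert (by simp [h.ne₁₂, h.ne₁₃]), Finset.sum_pair h.ne₂₃, add_assoc]

theorem IsTriple.exists_apply_eq (h : IsTriple a b c) (x y z : β) :
    ∃ f : α → β, f a = x ∧ f b = y ∧ f c = z := by
  classical
  exact ⟨fun m => if m = a then x else if m = b then y else z, by simp, by simp [h.ne₁₂.symm],
    by simp [h.ne₁₃.symm, h.ne₂₃.symm]⟩

theorem IsTriple.funext {f g : α → β} (h : IsTriple a b c) (ha : f a = g a) (hb : f b = g b)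
    (hc : f c = g c) : f = g := by
  ext x
  obtain rfl | rfl | rfl := h.eq_or_eq_or_eq x <;> assumption

theorem IsTriple.sum_fun_eq [Fintype α] [DecidableEq α] [Fintype β] {A : Type*} [AddCommMonoid A]
    (h : IsTriple a b c) (F : β → β → β → A) :
    ∑ s : α → β, F (s a) (s b) (s c) = ∑ x, ∑ y, ∑ z, F x y z := by
  have hbij : Function.Bijective fun s : α → β => (s a, s b, s c) := by
    constructor
    · intro s t hst
      simp only [Prod.mk.injEq] at hst
      exact h.funext hst.1 hst.2.1 hst.2.2
    · rintro ⟨x, y, z⟩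
      obtain ⟨f, rfl, rfl, rfl⟩ := h.exists_apply_eq x y z
      exact ⟨f, rfl⟩
  rw [hbij.sum_comp fun t : β × β × β => F t.1 t.2.1 t.2.2]
  simp only [Fintype.sum_prod_type]

variable [Fintype α] {s t : α → ZMod 2}

theorem exists_isTriple_of_sum_eq (hα : Fintype.card α = 3) (hst : ∑ x, s x = ∑ x, t x)
    (hne : s ≠ t) :
    ∃ a b c, IsTriple a b c ∧ t a = s a ∧ t b = s b + 1 ∧ t c = s c + 1 := by
  obtain ⟨b, hb⟩ := Function.ne_iff.1 hne
  obtain ⟨x, y, h⟩ := exists_isTriple hα b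
  rw [h.sum_eq, h.sum_eq] at hst
  have key : ∀ s₁ t₁ s₂ t₂ s₃ t₃ : ZMod 2, s₁ ≠ t₁ → s₁ + s₂ + s₃ = t₁ + t₂ + t₃ →
      t₁ = s₁ + 1 ∧ (t₂ = s₂ ∧ t₃ = s₃ + 1 ∨ t₂ = s₂ + 1 ∧ t₃ = s₃) := by
    decide
  obtain ⟨hb', ⟨hx, hy⟩ | ⟨hx, hy⟩⟩ := key _ _ _ _ _ _ hb hst
  · exact ⟨x, b, y, h.swap, hx, hb', hy⟩
  · exact ⟨y, b, x, h.rotate.rotate, hy, hb', hx⟩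

theorem one_add_sum_sgn_mul_sgn (hα : Fintype.card α = 3)
    (hst : ∑ x, s x = ∑ x, t x) :
    1 + ∑ x, sgn (s x) * sgn (t x) = if s = t then 4 else 0 := by
  split_ifs with h
  · subst h
    simp only [sgn_mul_self, Finset.sum_const, Finset.card_univ, hα]
    norm_num
  · obtain ⟨a, b, c, habc, ha, hb, hc⟩ := exists_isTriple_of_sum_eq hα hst h
    rw [habc.sum_eq, ha, hb, hc, sgn_add_one, sgn_add_one, mul_neg, mul_neg, sgn_mul_self,
      sgn_mul_self, sgn_mul_self]
    norm_num

end Triple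

/-! ### Extreme points -/

section Convex

variable {E F : Type*} [AddCommGroup E] [Module ℝ E]

theorem map_mem_extremePoints_image_iff [AddCommGroup F] [Module ℝ F] (f : E →ᵃ[ℝ] F)
    (hf : Function.Injective f) {A : Set E} {x : E} :
    f x ∈ (f '' A).extremePoints ℝ ↔ x ∈ A.extremePoints ℝ := by
  simp only [mem_extremePoints_iff_left, hf.mem_set_image, Set.forall_mem_image,
    ← image_openSegment, hf.eq_iff]

/-- The perturbation `u ± ε d` stays feasible for small `ε`, because the inequalities that are
strict at `u` survive it. -/
theorem eq_zero_of_mem_extremePoints_polyhedron {I : Type*} [Finite I] {φ : I → E →ₗ[ℝ] ℝ}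
    {r : I → ℝ} {u d : E} (hu : u ∈ Set.extremePoints ℝ {x | ∀ i, 0 ≤ r i + φ i x})
    (hd : ∀ i, r i + φ i u = 0 → φ i d = 0) : d = 0 := by
  have hnear (i : I) : ∀ᶠ ε in nhds (0 : ℝ), 0 ≤ r i + φ i (u + ε • d) := by
    obtain htight | hstrict := (hu.1 i).eq_or_lt
    · simp [hd i htight.symm, ← htight]
    · have hcont : Continuous fun ε : ℝ => r i + φ i (u + ε • d) := by
        simp only [map_add, map_smul]
        fun_prop
      filter_upwards [hcont.continuousAt.eventually_const_lt (by simpa using hstrict)] with ε hε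
      exact hε.le
  obtain ⟨δ, hδ, hfeas⟩ := Metric.eventually_nhds_iff.1 (Filter.eventually_all.2 hnear)
  have hplus := @hfeas (δ / 2) (by rw [Real.dist_0_eq_abs, abs_of_pos] <;> linarith)
  have hminus := @hfeas (-(δ / 2)) (by rw [Real.dist_0_eq_abs, abs_neg, abs_of_pos] <;> linarith)
  have hmid : u ∈ openSegment ℝ (u + (δ / 2) • d) (u + (-(δ / 2)) • d) :=
    ⟨1 / 2, 1 / 2, by norm_num, by norm_num, by norm_num, by module⟩
  have hfix : u + (δ / 2) • d = u := (mem_extremePoints_iff_left.1 hu).2 _ hplus _ hminus hmid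
  exact (smul_eq_zero.1 (left_eq_add.1 hfix.symm)).resolve_left (by positivity)

end Convex

/-- The measurements whose outcome is deterministic for the expectation values `u`. -/
noncomputable def detSet {M : Type*} [Fintype M] (u : M → ℝ) : Finset M := {m | |u m| = 1}

theorem mem_detSet {M : Type*} [Fintype M] {u : M → ℝ} {m : M} : m ∈ detSet u ↔ |u m| = 1 := by
  simp [detSet]

section TripleSystem

variable {M ι : Type} [DecidableEq M]

/-- Scenarios whose contexts have three elements and pairwise meet in at most one: partial linear
spaces with lines of size three. -/
class Scenario.IsTripleSystem (S : Scenario M ι) : Prop where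
  card_context (C : ι) : (S.context C).card = 3
  card_inter_le_one {C C' : ι} (h : C ≠ C') : (S.context C ∩ S.context C').card ≤ 1

/-- The expectation values prescribed by `s : Ω → ℤ₂`: `(-1) ^ s m` on `Ω` and `0` off `Ω`. -/
noncomputable def signVec (Ω : Finset M) (s : Ω → ZMod 2) (m : M) : ℝ :=
  if h : m ∈ Ω then sgn (s ⟨m, h⟩) else 0

theorem marginal_empty {C U : Finset M} (h : U ⊆ C) (hU : U = ∅) (q : (C → ZMod 2) → ℝ)
    (t : U → ZMod 2) : marginal h q t = ∑ s, q s := by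
  subst hU
  rw [marginal, Finset.filter_true_of_mem fun s _ => Subsingleton.elim _ _]

theorem marginal_singleton {C U : Finset M} (h : U ⊆ C) {m : M} (hU : U = {m}) (hm : m ∈ U)
    (q : (C → ZMod 2) → ℝ) (t : U → ZMod 2) :
    marginal h q t = ∑ s : C → ZMod 2 with s ⟨m, h hm⟩ = t ⟨m, hm⟩, q s := by
  subst hU
  have hext (f g : ({m} : Finset M) → ZMod 2) : f = g ↔ f ⟨m, hm⟩ = g ⟨m, hm⟩ :=
    ⟨fun e => congrFun e _, fun e => funext fun x => by rwa [Subsingleton.elim x ⟨m, hm⟩]⟩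
  simp only [marginal, hext, Finset.restrict₂]

namespace Scenario

variable (S : Scenario M ι)

/-! ### Expectation values -/

/-- The linear form `u ↦ ∑ m, (-1) ^ s m * u m` on a context: `(1 + S.signedSum C s u) / 4` is the
probability of `s` when the measurements have expectation values `u`. -/
noncomputable def signedSum (C : ι) (s : S.context C → ZMod 2) : (M → ℝ) →ₗ[ℝ] ℝ :=
  ∑ m, sgn (s m) • LinearMap.proj (m : M)

theorem signedSum_apply (C : ι) (s : S.context C → ZMod 2) (u : M → ℝ) :
    S.signedSum C s u = ∑ m, sgn (s m) * u m := by
  simp [signedSum]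

/-- The expectation values of the measurements in the families of `S.NSβ β`, by
`image_ofExpectation`. -/
def expectationPolytope (β : ι → ZMod 2) : Set (M → ℝ) :=
  {u | ∀ C, ∀ s ∈ S.O β C, 0 ≤ 1 + S.signedSum C s u}

/-- The family with prescribed expectation values that is supported in the sets `S.O β C`. -/
noncomputable def ofExpectation (β : ι → ZMod 2) : (M → ℝ) →ᵃ[ℝ] S.Family where
  toFun u C s := if ∑ m, s m = β C then (1 + S.signedSum C s u) / 4 else 0
  linear := LinearMap.pi fun C => LinearMap.pi fun s =>
    if ∑ m, s m = β C then (1 / 4 : ℝ) • S.signedSum C s else 0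
  map_vadd' u v := by
    ext C s
    simp only [vadd_eq_add, map_add, Pi.add_apply, LinearMap.pi_apply]
    split_ifs
    · simp only [LinearMap.smul_apply, smul_eq_mul]
      ring
    · simp

theorem ofExpectation_apply (β : ι → ZMod 2) (u : M → ℝ) (C : ι) (s : S.context C → ZMod 2) :
    S.ofExpectation β u C s = if ∑ m, s m = β C then (1 + S.signedSum C s u) / 4 else 0 :=
  rfl

/-- The expectation value of each measurement in the family `p`, computed in a chosen context. -/
noncomputable def expectation (p : S.Family) (m : M) : ℝ :=
  2 * S.probZero p (S.cover m).choose ⟨m, (S.cover m).choose_spec⟩ - 1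

variable {S} {β : ι → ZMod 2} {u : M → ℝ}

theorem probZero_eq_sum_marginal (p : S.Family) {C : ι} {U : Finset M} (h : U ⊆ S.context C)
    {m : M} (hm : m ∈ U) :
    S.probZero p C ⟨m, h hm⟩ = ∑ t : U → ZMod 2 with t ⟨m, hm⟩ = 0, marginal h (p C) t := by
  simp only [marginal, probZero]
  rw [Finset.sum_fiberwise_eq_sum_filter]
  simp

theorem probZero_eq_of_mem_NS {p : S.Family} (hp : p ∈ S.NS) {C C' : ι} {m : M}
    (h : m ∈ S.context C) (h' : m ∈ S.context C') :
    S.probZero p C ⟨m, h⟩ = S.probZero p C' ⟨m, h'⟩ := by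
  have hm : m ∈ S.context C ∩ S.context C' := Finset.mem_inter.2 ⟨h, h'⟩
  rw [probZero_eq_sum_marginal p Finset.inter_subset_left hm,
    probZero_eq_sum_marginal p Finset.inter_subset_right hm, hp.2.2 C C']

theorem expectation_eq {p : S.Family} (hp : p ∈ S.NS) {C : ι} (m : S.context C) :
    S.expectation p m = 2 * S.probZero p C m - 1 := by
  rw [expectation, probZero_eq_of_mem_NS hp _ m.2]

theorem expectation_eq_sum {p : S.Family} (hp : p ∈ S.NS) (C : ι) (m : S.context C) :
    S.expectation p m = ∑ t, p C t * sgn (t m) := by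
  have hsgn (z : ZMod 2) (x : ℝ) : x * sgn z = 2 * (if z = 0 then x else 0) - x := by
    obtain rfl | rfl := eq_zero_or_one z
    · simp; ring
    · simp [sgn_one]
  simp only [expectation_eq hp, hsgn, Finset.sum_sub_distrib, ← Finset.mul_sum, hp.2.1 C, probZero,
    Finset.sum_filter]

theorem signedSum_eq {C : ι} {a b c : S.context C} (h : IsTriple a b c)
    (s : S.context C → ZMod 2) (u : M → ℝ) :
    S.signedSum C s u = sgn (s a) * u a + sgn (s b) * u b + sgn (s c) * u c := by
  rw [signedSum_apply, h.sum_eq]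

theorem le_of_isTriple (hu : u ∈ S.expectationPolytope β) {C : ι} {a b c : S.context C}
    (h : IsTriple a b c) (z w : ZMod 2) :
    0 ≤ 1 + sgn z * u a + sgn w * (u b + sgn (β C + z) * u c) := by
  obtain ⟨s, rfl, rfl, hc⟩ := h.exists_apply_eq z w (β C + z + w)
  have hs : s ∈ S.O β C := by
    have hcancel : ∀ x y d : ZMod 2, x + y + (d + x + y) = d := by decide
    exact (h.sum_eq s).trans (by rw [hc, hcancel])
  have := hu C s hs
  rw [signedSum_eq h, hc, AddChar.map_add_eq_mul] at this
  linarith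

theorem eq_sgn_mul_of_abs_eq_one (hu : u ∈ S.expectationPolytope β) {C : ι} {a b c : S.context C}
    (h : IsTriple a b c) (ha : |u a| = 1) : u b = sgn (β C + signOf (u a)) * u c := by
  have hle := le_of_isTriple hu h (signOf (u a) + 1)
  have h₀ := hle 0
  have h₁ := hle 1
  have hsq : sgn (signOf (u a)) * u a = 1 := by
    conv_lhs => rw [← sgn_signOf ha, signOf_sgn, sgn_mul_self]
  rw [sgn_add_one, ← add_assoc, sgn_add_one, neg_mul, hsq] at h₀ h₁
  rw [AddChar.map_zero_eq_one] at h₀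
  rw [sgn_one] at h₁
  linarith

theorem abs_eq_of_abs_eq_one (hu : u ∈ S.expectationPolytope β) {C : ι} {a b c : S.context C}
    (h : IsTriple a b c) (ha : |u a| = 1) : |u b| = |u c| := by
  rw [eq_sgn_mul_of_abs_eq_one hu h ha, abs_mul, abs_sgn, one_mul]

theorem eq_zero_of_tight [Finite M] {d : M → ℝ}
    (hu : u ∈ (S.expectationPolytope β).extremePoints ℝ)
    (hd : ∀ C, ∀ s ∈ S.O β C, 1 + S.signedSum C s u = 0 → S.signedSum C s d = 0) : d = 0 := by
  have : Finite ι := Finite.of_injective S.context S.context_injective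
  have hpolyhedron : S.expectationPolytope β =
      {x | ∀ i : Σ C, S.O β C, 0 ≤ 1 + S.signedSum i.1 i.2.1 x} := by
    ext v
    simp [expectationPolytope, Sigma.forall]
  rw [hpolyhedron] at hu
  exact eq_zero_of_mem_extremePoints_polyhedron hu fun i => hd i.1 i.2.1 i.2.2

variable [S.IsTripleSystem]

theorem card_coe_context (C : ι) : Fintype.card (S.context C) = 3 := by
  rw [Fintype.card_coe, IsTripleSystem.card_context]

/-- Fourier inversion on `O_β(C)`: the sign characters of distinct `s, t ∈ O_β(C)` satisfy
`1 + ∑ m, (-1) ^ (s m + t m) = 0`. -/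
theorem four_mul_eq {p : S.Family} (hp : p ∈ S.NSβ β) {C : ι} {s : S.context C → ZMod 2}
    (hs : s ∈ S.O β C) : 4 * p C s = 1 + S.signedSum C s (S.expectation p) := by
  have hexpand : 1 + S.signedSum C s (S.expectation p) =
      ∑ t, p C t * (1 + ∑ m, sgn (s m) * sgn (t m)) := by
    simp only [signedSum_apply, expectation_eq_sum hp.1, mul_add, Finset.sum_add_distrib, mul_one,
      hp.1.2.1 C, Finset.mul_sum]
    rw [Finset.sum_comm]
    simp only [mul_left_comm]
  have horth (t : S.context C → ZMod 2) :
      p C t * (1 + ∑ m, sgn (s m) * sgn (t m)) = if t = s then 4 * p C s else 0 := by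
    by_cases ht : p C t = 0
    · simp only [ht, zero_mul]
      split_ifs with hts
      · simp [← hts, ht]
      · rfl
    · rw [one_add_sum_sgn_mul_sgn (card_coe_context C) (hs.trans (hp.2 C ht).symm)]
      simp only [eq_comm (a := s)]
      split_ifs with hts
      · rw [hts, mul_comm]
      · simp
  rw [hexpand, Finset.sum_congr rfl fun t _ => horth t, Fintype.sum_ite_eq']

theorem expectation_mem {p : S.Family} (hp : p ∈ S.NSβ β) :
    S.expectation p ∈ S.expectationPolytope β := fun C s hs => by
  rw [← four_mul_eq hp hs]
  exact mul_nonneg (by norm_num) (hp.1.1 C s)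

theorem ofExpectation_expectation {p : S.Family} (hp : p ∈ S.NSβ β) :
    S.ofExpectation β (S.expectation p) = p := by
  funext C s
  rw [ofExpectation_apply]
  split_ifs with h
  · rw [← four_mul_eq hp h, mul_div_cancel_left₀ _ (by norm_num)]
  · exact (Function.notMem_support.1 fun hs => h (hp.2 C hs)).symm

theorem sum_filter_ofExpectation (β : ι → ZMod 2) (u : M → ℝ) (C : ι) (m : S.context C)
    (w : ZMod 2) :
    ∑ s : S.context C → ZMod 2 with s m = w, S.ofExpectation β u C s = (1 + sgn w * u m) / 2 := by
  obtain ⟨b, c, h⟩ := exists_isTriple (card_coe_context C) m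
  simp only [Finset.sum_filter, ofExpectation_apply, signedSum_apply, h.sum_eq]
  rw [h.sum_fun_eq fun x y z => if x = w then
    (if x + y + z = β C then (1 + (sgn x * u m + sgn y * u b + sgn z * u c)) / 4 else 0) else 0]
  simp only [sum_zmod_two]
  obtain rfl | rfl := eq_zero_or_one w <;> obtain hβ | hβ := eq_zero_or_one (β C) <;>
    simp [hβ, sgn_one, CharTwo.add_self_eq_zero] <;> ring

theorem probZero_ofExpectation (β : ι → ZMod 2) (u : M → ℝ) (C : ι) (m : S.context C) :
    S.probZero (S.ofExpectation β u) C m = (1 + u m) / 2 := by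
  rw [probZero, sum_filter_ofExpectation, AddChar.map_zero_eq_one, one_mul]

theorem expectation_ofExpectation (β : ι → ZMod 2) (u : M → ℝ) :
    S.expectation (S.ofExpectation β u) = u := by
  funext m
  rw [expectation, probZero_ofExpectation]
  ring

theorem ofExpectation_injective (β : ι → ZMod 2) : Function.Injective (S.ofExpectation β) :=
  Function.LeftInverse.injective (expectation_ofExpectation β)

theorem sum_ofExpectation (β : ι → ZMod 2) (u : M → ℝ) (C : ι) :
    ∑ s, S.ofExpectation β u C s = 1 := by
  obtain ⟨m⟩ : Nonempty (S.context C) := Fintype.card_pos_iff.1 (by rw [card_coe_context]; norm_num)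
  rw [← Finset.sum_fiberwise _ fun s => s m, sum_zmod_two, sum_filter_ofExpectation,
    sum_filter_ofExpectation, AddChar.map_zero_eq_one, sgn_one]
  ring

theorem ofExpectation_mem_NSβ (hu : u ∈ S.expectationPolytope β) :
    S.ofExpectation β u ∈ S.NSβ β := by
  refine ⟨⟨fun C s => ?_, sum_ofExpectation β u, fun C C' => ?_⟩, fun C s hs => ?_⟩
  · rw [ofExpectation_apply]
    split_ifs with h
    · exact div_nonneg (hu C s h) (by norm_num)
    · exact le_rfl
  · obtain rfl | hC := eq_or_ne C C'
    · rfl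
    funext t
    obtain hU | ⟨m, hU⟩ := (Nat.le_one_iff_eq_zero_or_eq_one.1
      (IsTripleSystem.card_inter_le_one (S := S) hC)).imp Finset.card_eq_zero.1 Finset.card_eq_one.1
    · rw [marginal_empty _ hU, marginal_empty _ hU, sum_ofExpectation, sum_ofExpectation]
    · have hm : m ∈ S.context C ∩ S.context C' := by simp [hU]
      rw [marginal_singleton _ hU hm, marginal_singleton _ hU hm,
        sum_filter_ofExpectation, sum_filter_ofExpectation]
  · exact of_not_not fun h => hs (if_neg h)

theorem image_ofExpectation (β : ι → ZMod 2) :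
    S.ofExpectation β '' S.expectationPolytope β = S.NSβ β :=
  Set.Subset.antisymm (Set.image_subset_iff.2 fun _ => ofExpectation_mem_NSβ)
    fun p hp => ⟨S.expectation p, expectation_mem hp, ofExpectation_expectation hp⟩

theorem ofExpectation_mem_extremePoints_iff :
    S.ofExpectation β u ∈ (S.NSβ β).extremePoints ℝ ↔
      u ∈ (S.expectationPolytope β).extremePoints ℝ := by
  rw [← image_ofExpectation, map_mem_extremePoints_image_iff _ (ofExpectation_injective β)]

theorem hasMarginals_iff {p : S.Family} (hp : p ∈ S.NSβ β) {Ω : Finset M} {s : Ω → ZMod 2} :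
    S.HasMarginals p Ω s ↔ p = S.ofExpectation β (signVec Ω s) := by
  obtain ⟨u, -, rfl⟩ := (image_ofExpectation β).ge hp
  have hval (m : M) : (1 + u m) / 2 = (if h : m ∈ Ω then (1 + (-1 : ℝ) ^ (s ⟨m, h⟩).val) / 2
      else 1 / 2) ↔ u m = signVec Ω s m := by
    rw [signVec]
    split_ifs
    · rw [sgn_apply]
      constructor <;> intro h <;> linarith
    · constructor <;> intro h <;> linarith
  rw [(ofExpectation_injective β).eq_iff, funext_iff]
  simp only [HasMarginals, probZero_ofExpectation, hval]
  exact ⟨fun h m => h _ ⟨m, (S.cover m).choose_spec⟩, fun h _ m => h m⟩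

/-! ### Deterministic measurements -/

theorem abs_le_one_of_mem (hu : u ∈ S.expectationPolytope β) (m : M) : |u m| ≤ 1 := by
  obtain ⟨C, hm⟩ := S.cover m
  obtain ⟨b, c, h⟩ := exists_isTriple (card_coe_context C) ⟨m, hm⟩
  have hle := le_of_isTriple hu h
  have hw (z : ZMod 2) : 0 ≤ 1 + sgn z * u m := by
    have h₀ := hle z 0
    have h₁ := hle z 1
    rw [AddChar.map_zero_eq_one] at h₀
    rw [sgn_one] at h₁
    linarith
  have h₀ := hw 0
  have h₁ := hw 1
  rw [AddChar.map_zero_eq_one] at h₀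
  rw [sgn_one] at h₁
  exact abs_le.2 ⟨by linarith, by linarith⟩

theorem sum_signOf (hu : u ∈ S.expectationPolytope β) {C : ι} {a : S.context C} (ha : |u a| = 1)
    (hne : ∀ m ∈ S.context C, u m ≠ 0) : ∑ m : S.context C, signOf (u m) = β C := by
  obtain ⟨b, c, h⟩ := exists_isTriple (card_coe_context C) a
  have hb := eq_sgn_mul_of_abs_eq_one hu h ha
  rw [← abs_mul_sgn_signOf (u b), ← abs_mul_sgn_signOf (u c), abs_eq_of_abs_eq_one hu h ha,
    mul_left_comm, ← AddChar.map_add_eq_mul] at hb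
  have hsign := sgn_injective (mul_left_cancel₀ (abs_ne_zero.2 (hne c c.2)) hb)
  have hcancel : ∀ x y d : ZMod 2, x + (d + x + y) + y = d := by decide
  rw [h.sum_eq, hsign, hcancel]

theorem isClosed_detSet [Fintype M] (hu : u ∈ S.expectationPolytope β) :
    S.IsClosed (detSet u) := by
  intro C a ha b hb hab
  rw [Finset.mem_inter, mem_detSet] at ha hb
  obtain ⟨c, h⟩ := exists_isTriple_of_ne (card_coe_context C) (a := ⟨a, ha.1⟩) (b := ⟨b, hb.1⟩)
    (by simpa using hab)
  have hdet (m : S.context C) : |u m| = 1 := by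
    obtain rfl | rfl | rfl := h.eq_or_eq_or_eq m
    exacts [ha.2, hb.2, (abs_eq_of_abs_eq_one hu h ha.2).symm.trans hb.2]
  exact fun m hm => mem_detSet.2 (hdet ⟨m, hm⟩)

theorem isOutcomeAssignment_detSet [Fintype M] (hu : u ∈ S.expectationPolytope β) :
    S.IsOutcomeAssignment β (detSet u) fun m => signOf (u m) := by
  intro C hC
  have hdet (m : M) (hm : m ∈ S.context C) : |u m| = 1 := mem_detSet.1 (hC hm)
  obtain ⟨a⟩ : Nonempty (S.context C) :=
    Fintype.card_pos_iff.1 (by rw [card_coe_context]; norm_num)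
  exact sum_signOf hu (hdet a a.2) fun m hm => abs_pos.1 (by rw [hdet m hm]; norm_num)

theorem signedSum_eq_zero_of_tight [Fintype M] {d : M → ℝ} (hd : ∀ m ∈ detSet u, d m = 0) {C : ι}
    {r s : S.context C → ZMod 2} (hrs : ∑ m, r m = ∑ m, s m) (hr : 1 + S.signedSum C r u = 0)
    (hs : 1 + S.signedSum C s u = 0) (hrd : S.signedSum C r d = 0) : S.signedSum C s d = 0 := by
  obtain rfl | hne := eq_or_ne r s
  · exact hrd
  obtain ⟨a, b, c, h, ha, hb, hc⟩ := exists_isTriple_of_sum_eq (card_coe_context C) hrs hne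
  rw [signedSum_eq h] at hr hs hrd ⊢
  rw [ha, hb, hc, sgn_add_one, sgn_add_one] at hs ⊢
  have hua : sgn (r a) * u a = -1 := by linarith
  have hda : d a = 0 := hd a <| mem_detSet.2 <| by simpa [abs_mul, abs_sgn] using congrArg abs hua
  rw [hda] at hrd ⊢
  linarith

/-- Two distinct tight inequalities on one context force a deterministic coordinate, so modulo
`detSet u` a context contributes at most one to the rank of the tight inequalities, and a context
inside `detSet u` contributes nothing. -/
theorem card_le_of_mem_extremePoints [Fintype M] [Fintype ι]
    (hu : u ∈ (S.expectationPolytope β).extremePoints ℝ) :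
    Fintype.card M ≤ (detSet u).card + Fintype.card {C // ¬ S.context C ⊆ detSet u} := by
  have htight (C : ι) : ∃ r, ∀ s ∈ S.O β C, 1 + S.signedSum C s u = 0 →
      r ∈ S.O β C ∧ 1 + S.signedSum C r u = 0 := by
    by_cases h : ∃ r ∈ S.O β C, 1 + S.signedSum C r u = 0
    · obtain ⟨r, hr⟩ := h
      exact ⟨r, fun _ _ _ => hr⟩
    · exact ⟨0, fun s hs hs₀ => absurd ⟨s, hs, hs₀⟩ h⟩
  choose r hr using htight
  let L : (M → ℝ) →ₗ[ℝ] (detSet u ⊕ {C // ¬ S.context C ⊆ detSet u} → ℝ) :=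
    LinearMap.pi (Sum.elim (fun m => LinearMap.proj m.1) fun C => S.signedSum C.1 (r C.1))
  have hker : LinearMap.ker L = ⊥ := by
    refine LinearMap.ker_eq_bot'.2 fun d hd => ?_
    have hdet (m : M) (hm : m ∈ detSet u) : d m = 0 := congrFun hd (.inl ⟨m, hm⟩)
    refine eq_zero_of_tight hu fun C s hs hs₀ => ?_
    by_cases hC : S.context C ⊆ detSet u
    · rw [signedSum_apply]
      exact Finset.sum_eq_zero fun m _ => by rw [hdet m (hC m.2), mul_zero]
    · obtain ⟨hrO, hr₀⟩ := hr C s hs hs₀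
      exact signedSum_eq_zero_of_tight hdet (hrO.trans hs.symm) hr₀ hs₀ (congrFun hd (.inr ⟨C, hC⟩))
  simpa using LinearMap.finrank_le_finrank_of_injective (LinearMap.ker_eq_bot.1 hker)

end Scenario

/-! ### Outcome assignments and vertices -/

section SignVec

variable {Ω : Finset M} {s : Ω → ZMod 2} {m : M}

theorem signVec_of_mem (hm : m ∈ Ω) : signVec Ω s m = sgn (s ⟨m, hm⟩) :=
  dif_pos hm

theorem signVec_of_notMem (hm : m ∉ Ω) : signVec Ω s m = 0 :=
  dif_neg hm

theorem abs_signVec_le_one (Ω : Finset M) (s : Ω → ZMod 2) (m : M) : |signVec Ω s m| ≤ 1 := by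
  rw [signVec]
  split_ifs <;> simp [abs_sgn]

theorem abs_signVec_eq_one_iff : |signVec Ω s m| = 1 ↔ m ∈ Ω := by
  rw [signVec]
  split_ifs with h <;> simp [h, abs_sgn]

theorem signVec_injective :
    Function.Injective fun x : (Ω : Finset M) × (Ω → ZMod 2) => signVec x.1 x.2 := by
  rintro ⟨Ω, s⟩ ⟨Ω', s'⟩ h
  obtain rfl : Ω = Ω' := by
    ext m
    rw [← abs_signVec_eq_one_iff (s := s), ← abs_signVec_eq_one_iff (s := s'),
      show signVec Ω s m = signVec Ω' s' m from congrFun h m]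
  congr
  funext m
  have := congrFun h m
  simp only [signVec_of_mem m.2] at this
  exact sgn_injective this

end SignVec

namespace Scenario

/-- Outcome assignments on the set of all measurements. -/
def IsGlobal (S : Scenario M ι) (β : ι → ZMod 2) (t : M → ZMod 2) : Prop :=
  ∀ C, ∑ m : S.context C, t m = β C

/-- `s : Ω → ℤ₂` is the restriction of a global outcome assignment. -/
def IsExtendable (S : Scenario M ι) (β : ι → ZMod 2) (Ω : Finset M) (s : Ω → ZMod 2) : Prop :=
  ∃ t, S.IsGlobal β t ∧ ∀ m : Ω, t m = s m

variable {S : Scenario M ι} {β : ι → ZMod 2} {u : M → ℝ} {Ω : Finset M} {s : Ω → ZMod 2}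

theorem IsGlobal.isOutcomeAssignment {t : M → ZMod 2} (ht : S.IsGlobal β t) (Ω : Finset M) :
    S.IsOutcomeAssignment β Ω fun m => t m :=
  fun C _ => ht C

theorem isClosed_univ [Fintype M] : S.IsClosed Finset.univ :=
  fun _ _ _ _ _ _ => Finset.subset_univ _

theorem IsOutcomeAssignment.isGlobal [Fintype M] {t : M → ZMod 2}
    (ht : S.IsOutcomeAssignment β Finset.univ fun m => t m) : S.IsGlobal β t :=
  fun C => ht C (Finset.subset_univ _)

variable (S) in
/-- Two measurements are adjacent if they are distinct and lie in a common context. -/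
def collinearityGraph : SimpleGraph M :=
  SimpleGraph.fromRel fun a b => ∃ C, a ∈ S.context C ∧ b ∈ S.context C

/-- Geometric hyperplanes with connected complement: closed sets that meet every context and whose
complement is nonempty and connected in the collinearity graph. -/
structure IsHyperplane (S : Scenario M ι) (Ω : Finset M) : Prop where
  isClosed : S.IsClosed Ω
  exists_mem_context (C : ι) : ∃ m ∈ S.context C, m ∈ Ω
  connected_compl : (S.collinearityGraph.induce {m | m ∉ Ω}).Connected

theorem IsHyperplane.exists_notMem (hΩ : S.IsHyperplane Ω) : ∃ m, m ∉ Ω :=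
  let ⟨m, hm⟩ := hΩ.connected_compl.nonempty
  ⟨m, hm⟩

theorem IsType1.isClosed (hΩ : S.IsType1 Ω) : S.IsClosed Ω := by
  intro C a ha b hb hab
  rw [Finset.mem_inter] at ha hb
  exact absurd ⟨ha.1, hb.1⟩ (hΩ.2 a ha.2 b hb.2 hab C)

theorem reachable_of_mem_context {C : ι} (a b : {m | m ∉ Ω}) (ha : a.1 ∈ S.context C)
    (hb : b.1 ∈ S.context C) : (S.collinearityGraph.induce {m | m ∉ Ω}).Reachable a b := by
  obtain rfl | hab := eq_or_ne a b
  · rfl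
  · have hadj : S.collinearityGraph.Adj a b :=
      (SimpleGraph.fromRel_adj _ _ _).2 ⟨Subtype.coe_injective.ne hab, .inl ⟨C, ha, hb⟩⟩
    exact SimpleGraph.Adj.reachable hadj

theorem ncard_cncPair [Finite M] {P : Finset M → Prop} {k : ℕ}
    (hmax : ∀ Ω, P Ω → Maximal (S.IsCnc β) Ω)
    (hcard : ∀ Ω, P Ω → Nat.card {s : Ω → ZMod 2 // S.IsOutcomeAssignment β Ω s} = k) :
    {x : S.CncPair β | P x.1.1}.ncard = {Ω | P Ω}.ncard * k := by
  let e : {x : S.CncPair β // P x.1.1} ≃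
      Σ Ω : {Ω // P Ω}, {s : Ω.1 → ZMod 2 // S.IsOutcomeAssignment β Ω.1 s} :=
    { toFun x := ⟨⟨x.1.1.1, x.2⟩, x.1.1.2, x.1.2.2⟩
      invFun y := ⟨⟨⟨y.1.1, y.2.1⟩, hmax _ y.1.2, y.2.2⟩, y.1.2⟩
      left_inv _ := rfl
      right_inv _ := rfl }
  have : Fintype {Ω // P Ω} := Fintype.ofFinite _
  calc {x : S.CncPair β | P x.1.1}.ncard
      = Nat.card {x : S.CncPair β // P x.1.1} := rfl
    _ = ∑ Ω : {Ω // P Ω}, Nat.card {s : Ω.1 → ZMod 2 // S.IsOutcomeAssignment β Ω.1 s} := by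
        rw [Nat.card_congr e, Nat.card_sigma]
    _ = Nat.card {Ω // P Ω} * k := by
        simp only [hcard _ (Subtype.prop _), Finset.sum_const, Finset.card_univ, smul_eq_mul,
          Nat.card_eq_fintype_card]

variable [S.IsTripleSystem]

theorem IsClosed.exists_isTriple (hΩ : S.IsClosed Ω) {C : ι} (hC : ¬ S.context C ⊆ Ω) :
    ∃ a b c : S.context C, IsTriple a b c ∧ (b : M) ∉ Ω ∧ (c : M) ∉ Ω := by
  obtain ⟨b, hbC, hb⟩ := Finset.not_subset.1 hC
  obtain ⟨x, y, h⟩ := Mermin.exists_isTriple (card_coe_context C) ⟨b, hbC⟩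
  by_cases hx : (x : M) ∈ Ω
  · refine ⟨x, ⟨b, hbC⟩, y, h.swap, hb, fun hy => hC ?_⟩
    exact hΩ C x (Finset.mem_inter.2 ⟨x.2, hx⟩) y (Finset.mem_inter.2 ⟨y.2, hy⟩)
      (Subtype.coe_injective.ne h.ne₂₃)
  · exact ⟨y, ⟨b, hbC⟩, x, h.rotate.rotate, hb, hx⟩

theorem signVec_mem (hΩ : S.IsClosed Ω) (hs : S.IsOutcomeAssignment β Ω s) :
    signVec Ω s ∈ S.expectationPolytope β := by
  intro C r hr
  by_cases hC : S.context C ⊆ Ω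
  · have hsum : S.signedSum C r (signVec Ω s) =
        ∑ m : S.context C, sgn (r m) * sgn (Finset.restrict₂ (π := fun _ => ZMod 2) hC s m) := by
      rw [signedSum_apply]
      exact Finset.sum_congr rfl fun m _ => by rw [signVec_of_mem (hC m.2)]; rfl
    rw [hsum, one_add_sum_sgn_mul_sgn (card_coe_context C) (hr.trans (hs C hC).symm)]
    split_ifs <;> norm_num
  · obtain ⟨a, b, c, h, hb, hc⟩ := hΩ.exists_isTriple hC
    have := neg_one_le_sgn_mul (abs_signVec_le_one Ω s a) (r a)
    rw [signedSum_eq h, signVec_of_notMem hb, signVec_of_notMem hc]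
    linarith

theorem signVec_mem_extremePoints (hmem : signVec Ω s ∈ S.expectationPolytope β)
    (huniq : ∀ v ∈ S.expectationPolytope β, (∀ m : Ω, v m = sgn (s m)) → v = signVec Ω s) :
    signVec Ω s ∈ (S.expectationPolytope β).extremePoints ℝ := by
  rw [mem_extremePoints_iff_left]
  refine ⟨hmem, fun y hy z hz hyz => huniq y hy fun m => ?_⟩
  obtain ⟨q, r, hq, hr, hqr, hcomb⟩ := hyz
  have hm : q * y m + r * z m = sgn (s m) :=
    (congrFun hcomb m).trans (signVec_of_mem m.2)
  have hym := abs_le.1 (abs_le_one_of_mem hy m)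
  have hzm := abs_le.1 (abs_le_one_of_mem hz m)
  obtain h | h := eq_zero_or_one (s m)
  · rw [h, AddChar.map_zero_eq_one] at hm ⊢
    nlinarith
  · rw [h, sgn_one] at hm ⊢
    nlinarith

theorem IsGlobal.signVec_mem_extremePoints [Fintype M] {t : M → ZMod 2} (ht : S.IsGlobal β t) :
    signVec Finset.univ (fun m => t m) ∈ (S.expectationPolytope β).extremePoints ℝ := by
  refine Scenario.signVec_mem_extremePoints
    (signVec_mem isClosed_univ (ht.isOutcomeAssignment _)) fun v _ hv => ?_
  ext m
  rw [signVec_of_mem (Finset.mem_univ m), hv ⟨m, Finset.mem_univ m⟩]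

theorem IsHyperplane.exists_isTriple (hΩ : S.IsHyperplane Ω) {C : ι} (hC : ¬ S.context C ⊆ Ω) :
    ∃ a b c : S.context C, IsTriple a b c ∧ (a : M) ∈ Ω ∧ (b : M) ∉ Ω ∧ (c : M) ∉ Ω := by
  obtain ⟨a, b, c, h, hb, hc⟩ := hΩ.isClosed.exists_isTriple hC
  obtain ⟨m, hmC, hm⟩ := hΩ.exists_mem_context C
  obtain rfl | rfl | rfl := h.eq_or_eq_or_eq ⟨m, hmC⟩
  exacts [⟨_, b, c, h, hm, hb, hc⟩, absurd hm hb, absurd hm hc]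

theorem IsHyperplane.exists_isTriple_of_notMem (hΩ : S.IsHyperplane Ω) {C : ι}
    {b c : S.context C} (hb : (b : M) ∉ Ω) (hc : (c : M) ∉ Ω) (hbc : b ≠ c) :
    ∃ a : S.context C, IsTriple a b c ∧ (a : M) ∈ Ω := by
  obtain ⟨a, h⟩ := exists_isTriple_of_ne (card_coe_context C) hbc
  obtain ⟨m, hmC, hm⟩ := hΩ.exists_mem_context C
  obtain rfl | rfl | rfl := h.eq_or_eq_or_eq ⟨m, hmC⟩
  exacts [absurd hm hb, absurd hm hc, ⟨_, h.rotate.rotate, hm⟩]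

theorem IsHyperplane.induction_notMem (hΩ : S.IsHyperplane Ω) {P : M → Prop}
    (hstep : ∀ C, ∀ a b c : S.context C, IsTriple a b c → (a : M) ∈ Ω → (b : M) ∉ Ω →
      (c : M) ∉ Ω → P b → P c)
    {x y : M} (hx : x ∉ Ω) (hPx : P x) (hy : y ∉ Ω) : P y := by
  have hall (y : {m | m ∉ Ω}) : P y := by
    have hreach := (SimpleGraph.reachable_iff_reflTransGen _ _).1
      (hΩ.connected_compl.preconnected ⟨x, hx⟩ y)
    induction hreach with
    | refl => exact hPx
    | @tail b c _ hbc hPb =>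
      have hadj : S.collinearityGraph.Adj b c := hbc
      obtain ⟨hne, hcol⟩ := (SimpleGraph.fromRel_adj _ _ _).1 hadj
      obtain ⟨C, hbC, hcC⟩ : ∃ C, (b : M) ∈ S.context C ∧ (c : M) ∈ S.context C :=
        hcol.elim id fun ⟨C, hcC, hbC⟩ => ⟨C, hbC, hcC⟩
      obtain ⟨a, h, ha⟩ := hΩ.exists_isTriple_of_notMem (b := ⟨b, hbC⟩) (c := ⟨c, hcC⟩) b.2 c.2
        fun e => hne (Subtype.mk.inj e)
      exact hstep C a _ _ h ha b.2 c.2 hPb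
  exact hall ⟨y, hy⟩

theorem IsHyperplane.eq_univ_of_ssubset [Fintype M] (hΩ : S.IsHyperplane Ω) {Ω' : Finset M}
    (hΩ' : S.IsClosed Ω') (h : Ω ⊂ Ω') : Ω' = Finset.univ := by
  obtain ⟨x, hx', hx⟩ := Finset.exists_of_ssubset h
  refine Finset.eq_univ_iff_forall.2 fun y => ?_
  by_cases hy : y ∈ Ω
  · exact h.1 hy
  refine hΩ.induction_notMem (P := (· ∈ Ω')) (fun C a b c habc ha _ _ hb => ?_) hx hx' hy
  exact hΩ' C a (Finset.mem_inter.2 ⟨a.2, h.1 ha⟩) b (Finset.mem_inter.2 ⟨b.2, hb⟩)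
    (Subtype.coe_injective.ne habc.ne₁₂) c.2

theorem IsHyperplane.maximal_isCnc [Finite M] (hΩ : S.IsHyperplane Ω)
    (hs : ∃ s, S.IsOutcomeAssignment β Ω s) (hβ : ¬ ∃ t, S.IsGlobal β t) :
    Maximal (S.IsCnc β) Ω := by
  have := Fintype.ofFinite M
  refine ⟨⟨hΩ.isClosed, hs⟩, fun Ω' ⟨hΩ', s', hs'⟩ hle => ?_⟩
  obtain rfl | hlt := hle.eq_or_lt
  · exact le_rfl
  · obtain rfl := hΩ.eq_univ_of_ssubset hΩ' hlt
    exact absurd ⟨fun m => s' ⟨m, Finset.mem_univ m⟩, hs'.isGlobal⟩ hβ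

theorem IsHyperplane.isGlobal_compl_add_one (hΩ : S.IsHyperplane Ω) {t : M → ZMod 2}
    (ht : S.IsGlobal β t) : S.IsGlobal β fun m => if m ∈ Ω then t m else t m + 1 := by
  intro C
  rw [← ht C]
  by_cases hC : S.context C ⊆ Ω
  · exact Finset.sum_congr rfl fun m _ => if_pos (hC m.2)
  · obtain ⟨a, b, c, h, ha, hb, hc⟩ := hΩ.exists_isTriple hC
    simp only [h.sum_eq, if_pos ha, if_neg hb, if_neg hc]
    linear_combination CharTwo.two_eq_zero (R := ZMod 2)

theorem IsHyperplane.eq_of_isGlobal (hΩ : S.IsHyperplane Ω) {t t' : M → ZMod 2}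
    (ht : S.IsGlobal β t) (ht' : S.IsGlobal β t') (heq : ∀ m ∈ Ω, t m = t' m) {x : M}
    (hx : x ∉ Ω) (htx : t x = t' x) : t = t' := by
  funext y
  by_cases hy : y ∈ Ω
  · exact heq y hy
  refine hΩ.induction_notMem (P := fun m => t m = t' m) (fun C a b c h ha _ _ hb => ?_) hx htx hy
  have hsum := (ht C).trans (ht' C).symm
  rw [h.sum_eq, h.sum_eq, heq a ha, hb] at hsum
  exact add_left_cancel hsum

theorem IsHyperplane.abs_eq_of_notMem (hΩ : S.IsHyperplane Ω) (hu : u ∈ S.expectationPolytope β)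
    (hdet : ∀ m ∈ Ω, |u m| = 1) {x y : M} (hx : x ∉ Ω) (hy : y ∉ Ω) : |u y| = |u x| :=
  hΩ.induction_notMem (P := fun m => |u m| = |u x|)
    (fun _ a _ _ h ha _ _ hb => (abs_eq_of_abs_eq_one hu h (hdet a ha)).symm.trans hb) hx rfl hy

theorem IsHyperplane.isGlobal_signOf (hΩ : S.IsHyperplane Ω) (hu : u ∈ S.expectationPolytope β)
    (hdet : ∀ m ∈ Ω, |u m| = 1) {x : M} (hx : x ∉ Ω) (hux : u x ≠ 0) :
    S.IsGlobal β fun m => signOf (u m) := by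
  have hne (m : M) : u m ≠ 0 := by
    rw [← abs_ne_zero]
    by_cases hm : m ∈ Ω
    · simp [hdet m hm]
    · rwa [hΩ.abs_eq_of_notMem hu hdet hx hm, abs_ne_zero]
  intro C
  obtain ⟨a, haC, ha⟩ := hΩ.exists_mem_context C
  exact sum_signOf hu (a := ⟨a, haC⟩) (hdet a ha) fun m _ => hne m

theorem IsHyperplane.eq_signVec (hΩ : S.IsHyperplane Ω) (hs : ¬ S.IsExtendable β Ω s)
    (hu : u ∈ S.expectationPolytope β) (heq : ∀ m : Ω, u m = sgn (s m)) : u = signVec Ω s := by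
  have hdet (m : M) (hm : m ∈ Ω) : |u m| = 1 := by rw [heq ⟨m, hm⟩, abs_sgn]
  funext m
  by_cases hm : m ∈ Ω
  · rw [signVec_of_mem hm, heq ⟨m, hm⟩]
  · rw [signVec_of_notMem hm]
    by_contra hum
    exact hs ⟨_, hΩ.isGlobal_signOf hu hdet hm hum, fun m => by rw [heq, signOf_sgn]⟩

theorem IsHyperplane.signVec_mem_extremePoints (hΩ : S.IsHyperplane Ω)
    (hs : S.IsOutcomeAssignment β Ω s) (hext : ¬ S.IsExtendable β Ω s) :
    signVec Ω s ∈ (S.expectationPolytope β).extremePoints ℝ :=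
  Scenario.signVec_mem_extremePoints (signVec_mem hΩ.isClosed hs)
    fun _ hv => hΩ.eq_signVec hext hv

/-- Such a `u` lies strictly between the vertices of two global assignments, `t` and the assignment
obtained from `t` by flipping all outcomes off `Ω`. -/
theorem IsHyperplane.notMem_extremePoints [Finite M] (hΩ : S.IsHyperplane Ω) {t : M → ZMod 2}
    (ht : S.IsGlobal β t) {r : ℝ} (hr : |r| < 1) (hon : ∀ m ∈ Ω, u m = sgn (t m))
    (hoff : ∀ m ∉ Ω, u m = r * sgn (t m)) : u ∉ (S.expectationPolytope β).extremePoints ℝ := by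
  intro hu
  have := Fintype.ofFinite M
  have hmem {t : M → ZMod 2} (ht : S.IsGlobal β t) :=
    signVec_mem isClosed_univ (ht.isOutcomeAssignment Finset.univ)
  obtain ⟨hr₁, hr₂⟩ := abs_lt.1 hr
  have hmid : u ∈ openSegment ℝ (signVec Finset.univ fun m => t m)
      (signVec Finset.univ fun m => if m.1 ∈ Ω then t m else t m + 1) := by
    refine ⟨(1 + r) / 2, (1 - r) / 2, by linarith, by linarith, by ring, funext fun m => ?_⟩
    simp only [Pi.add_apply, Pi.smul_apply, smul_eq_mul, signVec_of_mem (Finset.mem_univ m)]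
    by_cases hm : m ∈ Ω
    · rw [if_pos hm, hon m hm]
      ring
    · rw [if_neg hm, hoff m hm, sgn_add_one]
      ring
  have heq := (mem_extremePoints_iff_left.1 hu).2 _ (hmem ht) _
    (hmem (hΩ.isGlobal_compl_add_one ht)) hmid
  obtain ⟨x, hx⟩ := hΩ.exists_notMem
  have habs := congrArg abs (congrFun heq x)
  rw [signVec_of_mem (Finset.mem_univ x), hoff x hx, abs_mul, abs_sgn, mul_one] at habs
  exact hr.ne habs.symm

theorem IsHyperplane.not_isExtendable_of_mem_extremePoints [Fintype M]
    (hu : u ∈ (S.expectationPolytope β).extremePoints ℝ) (hΩ : S.IsHyperplane (detSet u)) :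
    ¬ S.IsExtendable β (detSet u) fun m => signOf (u m) := by
  rintro ⟨t, ht, htu⟩
  have hdet (m : M) (hm : m ∈ detSet u) : |u m| = 1 := mem_detSet.1 hm
  by_cases hzero : ∀ m ∉ detSet u, u m = 0
  · refine hΩ.notMem_extremePoints ht (r := 0) (by norm_num) (fun m hm => ?_) (fun m hm => ?_) hu
    · rw [htu ⟨m, hm⟩, sgn_signOf (hdet m hm)]
    · rw [hzero m hm, zero_mul]
  · push Not at hzero
    obtain ⟨x, hx, hux⟩ := hzero
    have hlt : |u x| < 1 := (abs_le_one_of_mem hu.1 x).lt_of_ne (mt mem_detSet.2 hx)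
    refine hΩ.notMem_extremePoints (hΩ.isGlobal_signOf hu.1 hdet hx hux) (r := |u x|)
      (by rwa [abs_abs]) (fun m hm => (sgn_signOf (hdet m hm)).symm) (fun m hm => ?_) hu
    rw [← hΩ.abs_eq_of_notMem hu.1 hdet hx hm, abs_mul_sgn_signOf]

theorem IsHyperplane.eq_signVec_of_mem_extremePoints [Fintype M]
    (hu : u ∈ (S.expectationPolytope β).extremePoints ℝ) (hΩ : S.IsHyperplane (detSet u)) :
    u = signVec (detSet u) fun m => signOf (u m) :=
  hΩ.eq_signVec (hΩ.not_isExtendable_of_mem_extremePoints hu) hu.1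
    fun m => (sgn_signOf (mem_detSet.1 m.2)).symm

theorem ofExpectation_signVec_univ [Fintype M] {t : M → ZMod 2} (ht : S.IsGlobal β t) (C : ι) :
    S.ofExpectation β (signVec Finset.univ fun m => t m) C =
      Pi.single (fun m : S.context C => t m) (1 : ℝ) := by
  funext r
  rw [ofExpectation_apply, Pi.single_apply]
  split_ifs with hr heq heq
  · simp only [signedSum_apply, signVec_of_mem (Finset.mem_univ _)]
    rw [one_add_sum_sgn_mul_sgn (card_coe_context C) (hr.trans (ht C).symm), if_pos heq]
    norm_num
  · simp only [signedSum_apply, signVec_of_mem (Finset.mem_univ _)]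
    rw [one_add_sum_sgn_mul_sgn (card_coe_context C) (hr.trans (ht C).symm), if_neg heq, zero_div]
  · exact absurd (heq ▸ ht C) hr
  · rfl

theorem exists_equiv_extremePoints {X : Type*} {f : X → (Ω : Finset M) × (Ω → ZMod 2)}
    (hf : Function.Injective f)
    (hext : ∀ u, u ∈ (S.expectationPolytope β).extremePoints ℝ ↔
      ∃ x, u = signVec (f x).1 (f x).2) :
    ∃ e : X ≃ (S.NSβ β).extremePoints ℝ,
      ∀ x, (e x).1 = S.ofExpectation β (signVec (f x).1 (f x).2) := by
  let g (x : X) : (S.NSβ β).extremePoints ℝ :=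
    ⟨S.ofExpectation β (signVec (f x).1 (f x).2),
      ofExpectation_mem_extremePoints_iff.2 ((hext _).2 ⟨x, rfl⟩)⟩
  have hg : Function.Bijective g := by
    constructor
    · intro x y hxy
      exact hf (signVec_injective (ofExpectation_injective β (congrArg Subtype.val hxy)))
    · rintro ⟨p, hp⟩
      obtain ⟨u, -, rfl⟩ := (image_ofExpectation β).ge hp.1
      obtain ⟨x, rfl⟩ := (hext u).1 (ofExpectation_mem_extremePoints_iff.1 hp)
      exact ⟨x, rfl⟩
  exact ⟨Equiv.ofBijective g hg, fun _ => rfl⟩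

theorem IsType1.isOutcomeAssignment (hΩ : S.IsType1 Ω) (s : Ω → ZMod 2) :
    S.IsOutcomeAssignment β Ω s := by
  intro C hC
  obtain ⟨a, b, ha, hb, hab⟩ := Finset.one_lt_card_iff.1
    (show 1 < (S.context C).card by rw [IsTripleSystem.card_context]; norm_num)
  exact absurd ⟨ha, hb⟩ (hΩ.2 a (hC ha) b (hC hb) hab C)

end Scenario

end TripleSystem

/-! ### Closed sets of the square -/

theorem mem_context_inl {i : Fin 3} {m : Meas} : m ∈ square.context (.inl i) ↔ m.1 = i := by
  revert i m; decide

theorem mem_context_inr {j : Fin 3} {m : Meas} : m ∈ square.context (.inr j) ↔ m.2 = j := by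
  revert j m; decide

instance : square.IsTripleSystem where
  card_context := by decide
  card_inter_le_one {C C'} := by revert C C'; decide

theorem sum_context_inl (i : Fin 3) (t : Meas → ZMod 2) :
    ∑ m : square.context (.inl i), t m = ∑ j, t (i, j) := by
  rw [Finset.sum_coe_sort (square.context (.inl i)) t]
  exact Finset.sum_image fun j _ j' _ h => congrArg Prod.snd h

theorem sum_context_inr (j : Fin 3) (t : Meas → ZMod 2) :
    ∑ m : square.context (.inr j), t m = ∑ i, t (i, j) := by
  rw [Finset.sum_coe_sort (square.context (.inr j)) t]
  exact Finset.sum_image fun i _ i' _ h => congrArg Prod.fst h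

/-- The union of the `i`-th horizontal and the `j`-th vertical context. -/
def cross (i j : Fin 3) : Finset Meas := square.context (.inl i) ∪ square.context (.inr j)

/-- The graph of a permutation. -/
def transversal (π : Equiv.Perm (Fin 3)) : Finset Meas := Finset.univ.image fun i => (i, π i)

theorem mem_cross {i j : Fin 3} {m : Meas} : m ∈ cross i j ↔ m.1 = i ∨ m.2 = j := by
  rw [cross, Finset.mem_union, mem_context_inl, mem_context_inr]

theorem mem_transversal {π : Equiv.Perm (Fin 3)} {m : Meas} :
    m ∈ transversal π ↔ π m.1 = m.2 := by
  obtain ⟨a, b⟩ := m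
  simp [transversal]

theorem card_transversal (π : Equiv.Perm (Fin 3)) : (transversal π).card = 3 := by
  rw [transversal, Finset.card_image_of_injective _ fun a b h => congrArg Prod.fst h,
    Finset.card_univ, Fintype.card_fin]

theorem transversal_injective : Function.Injective transversal := fun π _ h =>
  Equiv.ext fun i => ((mem_transversal (m := (i, π i))).1 (h ▸ mem_transversal.2 rfl)).symm

theorem cross_injective : Function.Injective fun x : Fin 3 × Fin 3 => cross x.1 x.2 := by
  decide

theorem exists_subset_transversal {Ω : Finset Meas} (hfst : Set.InjOn Prod.fst (Ω : Set Meas))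
    (hsnd : Set.InjOn Prod.snd (Ω : Set Meas)) : ∃ π, Ω ⊆ transversal π := by
  let f (i : Fin 3) : Fin 3 := (Function.invFunOn Prod.fst (Ω : Set Meas) i).2
  have hf {m : Meas} (hm : m ∈ Ω) : f m.1 = m.2 := congrArg Prod.snd (hfst.leftInvOn_invFunOn hm)
  have hinj : Set.InjOn f (Prod.fst '' (Ω : Set Meas)) := by
    rintro _ ⟨a, ha, rfl⟩ _ ⟨b, hb, rfl⟩ hab
    rw [hf ha, hf hb] at hab
    exact congrArg Prod.fst (hsnd ha hb hab)
  obtain ⟨g, hg⟩ := Set.MapsTo.exists_equiv_extend_of_card_eq (t := (Finset.univ : Finset (Fin 3)))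
    rfl (fun _ _ => Finset.mem_coe.2 (Finset.mem_univ _)) hinj
  exact ⟨g.trans (Equiv.subtypeUnivEquiv Finset.mem_univ), fun m hm =>
    mem_transversal.2 ((hg _ (Set.mem_image_of_mem _ hm)).trans (hf hm))⟩

theorem exists_subset_transversal_of_noncollinear {Ω : Finset Meas}
    (h : ∀ a ∈ Ω, ∀ b ∈ Ω, a ≠ b → ∀ C, ¬ (a ∈ square.context C ∧ b ∈ square.context C)) :
    ∃ π, Ω ⊆ transversal π :=
  exists_subset_transversal
    (fun a ha b hb hab => of_not_not fun hne =>
      h a ha b hb hne (.inl b.1) ⟨mem_context_inl.2 hab, mem_context_inl.2 rfl⟩)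
    (fun a ha b hb hab => of_not_not fun hne =>
      h a ha b hb hne (.inr b.2) ⟨mem_context_inr.2 hab, mem_context_inr.2 rfl⟩)

theorem isType1_transversal (π : Equiv.Perm (Fin 3)) : square.IsType1 (transversal π) := by
  refine ⟨card_transversal π, fun a ha b hb hab C hC => hab ?_⟩
  rw [mem_transversal] at ha hb
  cases C with
  | inl i =>
    have hfst : a.1 = b.1 := (mem_context_inl.1 hC.1).trans (mem_context_inl.1 hC.2).symm
    exact Prod.ext hfst (by rw [← ha, ← hb, hfst])
  | inr j =>
    have hsnd : a.2 = b.2 := (mem_context_inr.1 hC.1).trans (mem_context_inr.1 hC.2).symm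
    exact Prod.ext (π.injective (by rw [ha, hb, hsnd])) hsnd

theorem isType1_iff {Ω : Finset Meas} : square.IsType1 Ω ↔ ∃ π, transversal π = Ω := by
  constructor
  · rintro ⟨hcard, h⟩
    obtain ⟨π, hπ⟩ := exists_subset_transversal_of_noncollinear h
    exact ⟨π, (Finset.eq_of_subset_of_card_le hπ (by rw [card_transversal, hcard])).symm⟩
  · rintro ⟨π, rfl⟩
    exact isType1_transversal π

theorem isType2_iff {Ω : Finset Meas} :
    square.IsType2 Ω ↔ ∃ x : Fin 3 × Fin 3, cross x.1 x.2 = Ω := by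
  constructor
  · rintro ⟨C, C', m, hne, hm, rfl⟩
    obtain ⟨hC, hC'⟩ := Finset.mem_inter.1 (hm ▸ Finset.mem_singleton_self m)
    rcases C with i | j <;> rcases C' with i' | j'
    · rw [mem_context_inl] at hC hC'
      exact absurd (congrArg Sum.inl (hC.symm.trans hC')) hne
    · exact ⟨(i, j'), rfl⟩
    · exact ⟨(i', j), Finset.union_comm _ _⟩
    · rw [mem_context_inr] at hC hC'
      exact absurd (congrArg Sum.inr (hC.symm.trans hC')) hne
  · rintro ⟨⟨i, j⟩, rfl⟩
    refine ⟨.inl i, .inr j, (i, j), Sum.inl_ne_inr, ?_, rfl⟩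
    ext m
    rw [Finset.mem_inter, mem_context_inl, mem_context_inr, Finset.mem_singleton, Prod.ext_iff]

theorem ncard_isType1 : {Ω | square.IsType1 Ω}.ncard = 6 := by
  have hrange : {Ω | square.IsType1 Ω} = Set.range transversal := Set.ext fun _ => isType1_iff
  rw [hrange, Set.ncard_range_of_injective transversal_injective, Nat.card_perm, Nat.card_fin]
  rfl

theorem ncard_isType2 : {Ω | square.IsType2 Ω}.ncard = 9 := by
  have hrange : {Ω | square.IsType2 Ω} = Set.range fun x : Fin 3 × Fin 3 => cross x.1 x.2 :=
    Set.ext fun _ => isType2_iff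
  rw [hrange, Set.ncard_range_of_injective cross_injective, Nat.card_prod, Nat.card_fin]

theorem isHyperplane_transversal (π : Equiv.Perm (Fin 3)) :
    square.IsHyperplane (transversal π) where
  isClosed := (isType1_transversal π).isClosed
  exists_mem_context
    | .inl i => ⟨(i, π i), mem_context_inl.2 rfl, mem_transversal.2 rfl⟩
    | .inr j => ⟨(π.symm j, j), mem_context_inr.2 rfl, mem_transversal.2 (π.apply_symm_apply j)⟩
  connected_compl := by
    have row (a b : {m | m ∉ transversal π}) (h : a.1.1 = b.1.1) :=
      Scenario.reachable_of_mem_context a b (mem_context_inl.2 h) (mem_context_inl.2 rfl)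
    have col (a b : {m | m ∉ transversal π}) (h : a.1.2 = b.1.2) :=
      Scenario.reachable_of_mem_context a b (mem_context_inr.2 h) (mem_context_inr.2 rfl)
    refine (SimpleGraph.connected_iff _).2 ⟨fun a b => ?_, ⟨(0, π 1), fun h => ?_⟩⟩
    · by_cases hab : π a.1.1 = b.1.2
      · by_cases hba : π b.1.1 = a.1.2
        · obtain ⟨k, hka, hkb⟩ : ∃ k, k ≠ a.1.1 ∧ k ≠ b.1.1 := by
            generalize a.1.1 = i, b.1.1 = j
            revert i j
            decide
          let x : {m | m ∉ transversal π} :=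
            ⟨(a.1.1, π k), fun h => hka (π.injective (mem_transversal.1 h)).symm⟩
          let y : {m | m ∉ transversal π} :=
            ⟨(b.1.1, π k), fun h => hkb (π.injective (mem_transversal.1 h)).symm⟩
          exact ((row a x rfl).trans (col x y rfl)).trans (row y b rfl)
        · let x : {m | m ∉ transversal π} := ⟨(b.1.1, a.1.2), mt mem_transversal.1 hba⟩
          exact (col a x rfl).trans (row x b rfl)
      · let x : {m | m ∉ transversal π} := ⟨(a.1.1, b.1.2), mt mem_transversal.1 hab⟩
        exact (row a x rfl).trans (col x b rfl)
    · exact zero_ne_one (π.injective (mem_transversal.1 h))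

theorem isClosed_cross (i j : Fin 3) : square.IsClosed (cross i j) := by
  rintro (k | k) a ha b hb hab m hm
  · rw [mem_context_inl] at hm
    rw [Finset.mem_inter, mem_context_inl, mem_cross] at ha hb
    rw [mem_cross, hm]
    by_contra! hne
    exact hab (Prod.ext (ha.1.trans hb.1.symm) (by grind))
  · rw [mem_context_inr] at hm
    rw [Finset.mem_inter, mem_context_inr, mem_cross] at ha hb
    rw [mem_cross, hm]
    by_contra! hne
    exact hab (Prod.ext (by grind) (ha.1.trans hb.1.symm))

theorem isHyperplane_cross (i j : Fin 3) : square.IsHyperplane (cross i j) where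
  isClosed := isClosed_cross i j
  exists_mem_context
    | .inl k => ⟨(k, j), mem_context_inl.2 rfl, mem_cross.2 (.inr rfl)⟩
    | .inr k => ⟨(i, k), mem_context_inr.2 rfl, mem_cross.2 (.inl rfl)⟩
  connected_compl := by
    have hne {m : Meas} (hm : m ∉ cross i j) : m.1 ≠ i ∧ m.2 ≠ j := by
      rwa [mem_cross, not_or] at hm
    obtain ⟨k, hk⟩ := exists_ne i
    obtain ⟨l, hl⟩ := exists_ne j
    refine (SimpleGraph.connected_iff _).2 ⟨fun a b => ?_, ⟨(k, l), by simp [mem_cross, hk, hl]⟩⟩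
    let x : {m | m ∉ cross i j} :=
      ⟨(a.1.1, b.1.2), by simp [mem_cross, (hne a.2).1, (hne b.2).2]⟩
    have hax := Scenario.reachable_of_mem_context a x
      (mem_context_inl.2 rfl) (mem_context_inl.2 rfl)
    have hxb := Scenario.reachable_of_mem_context x b
      (mem_context_inr.2 rfl) (mem_context_inr.2 rfl)
    exact hax.trans hxb

theorem exists_union_eq_cross {C : Ctx} {x : Meas} (hx : x ∉ square.context C) :
    ∃ C' i j, x ∈ square.context C' ∧ (∃ y ∈ square.context C', y ∈ square.context C) ∧
      square.context C ∪ square.context C' = cross i j := by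
  cases C with
  | inl i => exact ⟨.inr x.2, i, x.2, mem_context_inr.2 rfl,
      ⟨(i, x.2), mem_context_inr.2 rfl, mem_context_inl.2 rfl⟩, rfl⟩
  | inr j => exact ⟨.inl x.1, x.1, j, mem_context_inl.2 rfl,
      ⟨(x.1, j), mem_context_inl.2 rfl, mem_context_inr.2 rfl⟩, Finset.union_comm _ _⟩

theorem isClosed_cases {Ω : Finset Meas} (hΩ : square.IsClosed Ω) :
    Ω = Finset.univ ∨ (∃ i j, Ω = cross i j) ∨ (∃ C, Ω = square.context C) ∨
      ∃ π, Ω ⊆ transversal π := by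
  by_cases hcontext : ∃ C, square.context C ⊆ Ω
  · obtain ⟨C, hC⟩ := hcontext
    obtain heq | hlt := hC.eq_or_ssubset
    · exact .inr (.inr (.inl ⟨C, heq.symm⟩))
    obtain ⟨x, hxΩ, hx⟩ := Finset.exists_of_ssubset hlt
    obtain ⟨C', i, j, hxC', ⟨y, hyC', hyC⟩, hij⟩ := exists_union_eq_cross hx
    have hC' : square.context C' ⊆ Ω :=
      hΩ C' x (Finset.mem_inter.2 ⟨hxC', hxΩ⟩) y (Finset.mem_inter.2 ⟨hyC', hC hyC⟩)
        fun e => hx (e ▸ hyC)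
    have hcross : cross i j ⊆ Ω := hij ▸ Finset.union_subset hC hC'
    obtain heq | hlt := hcross.eq_or_ssubset
    · exact .inr (.inl ⟨i, j, heq.symm⟩)
    · exact .inl ((isHyperplane_cross i j).eq_univ_of_ssubset hΩ hlt)
  · refine .inr (.inr (.inr (exists_subset_transversal_of_noncollinear ?_)))
    rintro a ha b hb hab C ⟨haC, hbC⟩
    exact hcontext ⟨C, hΩ C a (Finset.mem_inter.2 ⟨haC, ha⟩) b (Finset.mem_inter.2 ⟨hbC, hb⟩) hab⟩

theorem exists_subset_isHyperplane {Ω : Finset Meas} (hΩ : square.IsClosed Ω)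
    (hne : Ω ≠ Finset.univ) :
    ∃ Ω', (square.IsType1 Ω' ∨ square.IsType2 Ω') ∧ square.IsHyperplane Ω' ∧ Ω ⊆ Ω' := by
  have of_cross {i j : Fin 3} (h : Ω ⊆ cross i j) :
      ∃ Ω', (square.IsType1 Ω' ∨ square.IsType2 Ω') ∧ square.IsHyperplane Ω' ∧ Ω ⊆ Ω' :=
    ⟨_, .inr (isType2_iff.2 ⟨(i, j), rfl⟩), isHyperplane_cross i j, h⟩
  obtain rfl | ⟨i, j, rfl⟩ | ⟨i | j, rfl⟩ | ⟨π, h⟩ := isClosed_cases hΩ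
  · exact absurd rfl hne
  · exact of_cross subset_rfl
  · exact of_cross (j := 0) Finset.subset_union_left
  · exact of_cross (i := 0) Finset.subset_union_right
  · exact ⟨_, .inl (isType1_transversal π), isHyperplane_transversal π, h⟩

theorem isHyperplane_iff {Ω : Finset Meas} :
    square.IsHyperplane Ω ↔ square.IsType1 Ω ∨ square.IsType2 Ω := by
  constructor
  · intro hΩ
    have hne {Ω' : Finset Meas} (hΩ' : square.IsHyperplane Ω') : Ω' ≠ Finset.univ :=
      let ⟨m, hm⟩ := hΩ'.exists_notMem
      fun h => hm (h ▸ Finset.mem_univ m)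
    obtain ⟨Ω', htype, hΩ', hle⟩ := exists_subset_isHyperplane hΩ.isClosed (hne hΩ)
    obtain rfl | hlt := hle.eq_or_ssubset
    · exact htype
    · exact absurd (hΩ.eq_univ_of_ssubset hΩ'.isClosed hlt) (hne hΩ')
  · rintro (h | h)
    · obtain ⟨π, rfl⟩ := isType1_iff.1 h
      exact isHyperplane_transversal π
    · obtain ⟨⟨i, j⟩, rfl⟩ := isType2_iff.1 h
      exact isHyperplane_cross i j

theorem eq_univ_or_isHyperplane {Ω : Finset Meas} (hΩ : square.IsClosed Ω)
    (hcard : 9 ≤ Ω.card + Fintype.card {C // ¬ square.context C ⊆ Ω}) :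
    Ω = Finset.univ ∨ square.IsHyperplane Ω := by
  obtain h | ⟨i, j, rfl⟩ | ⟨C, rfl⟩ | ⟨π, hπ⟩ := isClosed_cases hΩ
  · exact .inl h
  · exact .inr (isHyperplane_cross i j)
  · have hlt : ∀ C, (square.context C).card +
        Fintype.card {C' // ¬ square.context C' ⊆ square.context C} < 9 := by
      decide
    exact absurd hcard (hlt C).not_ge
  · have hle : Fintype.card {C // ¬ square.context C ⊆ Ω} ≤ 6 := Fintype.card_subtype_le _
    have heq : Ω = transversal π :=
      Finset.eq_of_subset_of_card_le hπ (by rw [card_transversal]; omega)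
    exact .inr (heq ▸ isHyperplane_transversal π)

/-! ### Outcome assignments on the square -/

theorem isGlobal_iff {β : Ctx → ZMod 2} {t : Meas → ZMod 2} :
    square.IsGlobal β t ↔
      (∀ i, ∑ j, t (i, j) = β (.inl i)) ∧ ∀ j, ∑ i, t (i, j) = β (.inr j) := by
  simp only [Scenario.IsGlobal, Sum.forall, sum_context_inl, sum_context_inr]

theorem isHom_iff {s : Meas → ZMod 2} : IsHom s ↔ square.IsGlobal β₀ s := by
  constructor
  · intro hs C
    obtain ⟨a⟩ : Nonempty (square.context C) :=
      Fintype.card_pos_iff.1 (by rw [Scenario.card_coe_context]; norm_num)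
    obtain ⟨b, c, h⟩ := exists_isTriple (Scenario.card_coe_context C) a
    have hC : square.context C = {a.1, b.1, c.1} := by
      ext m
      simp only [Finset.mem_insert, Finset.mem_singleton]
      constructor
      · intro hm
        simpa only [Subtype.ext_iff] using h.eq_or_eq_or_eq ⟨m, hm⟩
      · rintro (rfl | rfl | rfl) <;> exact Subtype.prop _
    rw [h.sum_eq, hs C a b c hC, CharTwo.add_self_eq_zero, β₀]
  · intro hs C a b c hC
    have hcard : (square.context C).card = 3 := Scenario.IsTripleSystem.card_context C
    have hsum : ∑ m ∈ square.context C, s m = 0 := by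
      rw [← Finset.sum_coe_sort]
      exact hs C
    rw [hC] at hcard hsum
    obtain ⟨hab, hac, hbc⟩ : a ≠ b ∧ a ≠ c ∧ b ≠ c := by
      refine ⟨?_, ?_, ?_⟩ <;> rintro rfl <;> grind [Finset.card_le_two]
    rw [Finset.sum_insert (by simp [hab, hac]), Finset.sum_pair hbc, ← add_assoc] at hsum
    exact (CharTwo.add_eq_zero.1 hsum).symm

theorem sum_eq_zero_of_isGlobal {β : Ctx → ZMod 2} {t : Meas → ZMod 2}
    (ht : square.IsGlobal β t) : ∑ C, β C = 0 := by
  obtain ⟨hrow, hcol⟩ := isGlobal_iff.1 ht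
  rw [Fintype.sum_sum_type, ← Finset.sum_congr rfl fun i _ => hrow i,
    ← Finset.sum_congr rfl fun j _ => hcol j, Finset.sum_comm, CharTwo.add_self_eq_zero]

theorem isGlobal_ext_of_corner {β : Ctx → ZMod 2} {s t : Meas → ZMod 2}
    (hs : square.IsGlobal β s) (ht : square.IsGlobal β t) (h : ∀ m ∈ corner, s m = t m) :
    s = t := by
  simp only [isGlobal_iff, Fin.sum_univ_three] at hs ht
  have row (i : Fin 3) (h₀ : s (i, 0) = t (i, 0)) (h₁ : s (i, 1) = t (i, 1)) :
      s (i, 2) = t (i, 2) := by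
    have := (hs.1 i).trans (ht.1 i).symm
    rwa [h₀, h₁, add_right_inj] at this
  have col (j : Fin 3) (h₀ : s (0, j) = t (0, j)) (h₁ : s (1, j) = t (1, j)) :
      s (2, j) = t (2, j) := by
    have := (hs.2 j).trans (ht.2 j).symm
    rwa [h₀, h₁, add_right_inj] at this
  have h₀₀ := h (0, 0) (by decide)
  have h₀₁ := h (0, 1) (by decide)
  have h₁₀ := h (1, 0) (by decide)
  have h₁₁ := h (1, 1) (by decide)
  have h₀₂ := row 0 h₀₀ h₀₁
  have h₁₂ := row 1 h₁₀ h₁₁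
  funext ⟨i, j⟩
  fin_cases i <;> fin_cases j
  exacts [h₀₀, h₀₁, h₀₂, h₁₀, h₁₁, h₁₂, col 0 h₀₀ h₁₀, col 1 h₀₁ h₁₁, col 2 h₀₂ h₁₂]

theorem exists_isGlobal_of_corner {β : Ctx → ZMod 2} (hβ : ∑ C, β C = 0)
    (f : corner → ZMod 2) : ∃ t, square.IsGlobal β t ∧ ∀ m : corner, t m = f m := by
  let a := f ⟨(0, 0), by decide⟩
  let b := f ⟨(0, 1), by decide⟩
  let c := f ⟨(1, 0), by decide⟩
  let d := f ⟨(1, 1), by decide⟩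
  let x := β (.inl 0) - a - b
  let y := β (.inl 1) - c - d
  let t (m : Meas) : ZMod 2 :=
    ![![a, b, x], ![c, d, y], ![β (.inr 0) - a - c, β (.inr 1) - b - d, β (.inr 2) - x - y]] m.1 m.2
  have hlast : β (.inr 0) - a - c + (β (.inr 1) - b - d) + (β (.inr 2) - x - y) = β (.inl 2) := by
    simp only [Fintype.sum_sum_type, Fin.sum_univ_three] at hβ
    linear_combination hβ - (β (.inl 0) + β (.inl 1) + β (.inl 2)) *
      CharTwo.two_eq_zero (R := ZMod 2)
  refine ⟨t, isGlobal_iff.2 ⟨fun i => ?_, fun j => ?_⟩, ?_⟩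
  · rw [Fin.sum_univ_three]
    fin_cases i
    exacts [by simp [t, x], by simp [t, y], hlast]
  · rw [Fin.sum_univ_three]
    fin_cases j <;> simp [t]
  · rintro ⟨m, hm⟩
    have hm' := hm
    simp only [corner, Finset.mem_insert, Finset.mem_singleton] at hm'
    obtain rfl | rfl | rfl | rfl := hm' <;> rfl

theorem bijective_restrict_corner {β : Ctx → ZMod 2} (hβ : ∑ C, β C = 0) :
    Function.Bijective fun (t : {t // square.IsGlobal β t}) (m : corner) => t.1 m := by
  constructor
  · intro s t h
    exact Subtype.ext (isGlobal_ext_of_corner s.2 t.2 fun m hm => congrFun h ⟨m, hm⟩)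
  · intro f
    obtain ⟨t, ht, htf⟩ := exists_isGlobal_of_corner hβ f
    exact ⟨⟨t, ht⟩, funext htf⟩

theorem card_isGlobal {β : Ctx → ZMod 2} (hβ : ∑ C, β C = 0) :
    Nat.card {t // square.IsGlobal β t} = 16 := by
  rw [Nat.card_congr (Equiv.ofBijective _ (bijective_restrict_corner hβ)), Nat.card_fun,
    Nat.card_zmod, Nat.card_eq_fintype_card, Fintype.card_coe]
  rfl

theorem context_subset_cross_iff {i j : Fin 3} {C : Ctx} :
    square.context C ⊆ cross i j ↔ C = .inl i ∨ C = .inr j := by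
  revert i j C; decide

theorem isOutcomeAssignment_cross_iff {β : Ctx → ZMod 2} {i j : Fin 3} {s : cross i j → ZMod 2} :
    square.IsOutcomeAssignment β (cross i j) s ↔
      (∑ k, s ⟨(i, k), mem_cross.2 (.inl rfl)⟩ = β (.inl i)) ∧
        ∑ k, s ⟨(k, j), mem_cross.2 (.inr rfl)⟩ = β (.inr j) := by
  obtain ⟨t, rfl⟩ := Subtype.surjective_restrict (β := fun _ => ZMod 2) (· ∈ cross i j) s
  constructor
  · intro h
    exact ⟨(sum_context_inl i t).symm.trans (h (.inl i) Finset.subset_union_left),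
      (sum_context_inr j t).symm.trans (h (.inr j) Finset.subset_union_right)⟩
  · rintro ⟨hi, hj⟩ C hC
    obtain rfl | rfl := context_subset_cross_iff.1 hC
    exacts [(sum_context_inl i t).trans hi, (sum_context_inr j t).trans hj]

theorem card_isOutcomeAssignment {β : Ctx → ZMod 2} {Ω : Finset Meas}
    (hΩ : square.IsHyperplane Ω) :
    Nat.card {s : Ω → ZMod 2 // square.IsOutcomeAssignment β Ω s} = 8 := by
  obtain h | h := isHyperplane_iff.1 hΩ
  · rw [Nat.card_congr (Equiv.subtypeUnivEquiv h.isOutcomeAssignment), Nat.card_fun, Nat.card_zmod,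
      Nat.card_eq_fintype_card, Fintype.card_coe, h.1]
    rfl
  · obtain ⟨⟨i, j⟩, rfl⟩ := isType2_iff.1 h
    have hcount : ∀ (i j : Fin 3) (x y : ZMod 2), Fintype.card {s : cross i j → ZMod 2 //
        (∑ k, s ⟨(i, k), mem_cross.2 (.inl rfl)⟩ = x) ∧
          ∑ k, s ⟨(k, j), mem_cross.2 (.inr rfl)⟩ = y} = 8 := by
      decide +kernel
    simp only [isOutcomeAssignment_cross_iff]
    rw [Nat.card_eq_fintype_card, hcount]

theorem isExtendable_of_sum_eq_zero {β : Ctx → ZMod 2} (hβ : ∑ C, β C = 0) {Ω : Finset Meas}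
    (hΩ : square.IsHyperplane Ω) {s : Ω → ZMod 2} (hs : square.IsOutcomeAssignment β Ω s) :
    square.IsExtendable β Ω s := by
  obtain ⟨x, hx⟩ := hΩ.exists_notMem
  let F (t : {t // square.IsGlobal β t}) :
      {s : Ω → ZMod 2 // square.IsOutcomeAssignment β Ω s} × ZMod 2 :=
    (⟨fun m => t.1 m, t.2.isOutcomeAssignment Ω⟩, t.1 x)
  have hinj : Function.Injective F := by
    intro t t' h
    obtain ⟨hΩ', hx'⟩ := Prod.mk.inj h
    exact Subtype.ext (hΩ.eq_of_isGlobal t.2 t'.2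
      (fun m hm => congrFun (Subtype.mk.inj hΩ') ⟨m, hm⟩) hx hx')
  have hcard : Nat.card {t // square.IsGlobal β t} =
      Nat.card ({s : Ω → ZMod 2 // square.IsOutcomeAssignment β Ω s} × ZMod 2) := by
    rw [card_isGlobal hβ, Nat.card_prod, card_isOutcomeAssignment hΩ, Nat.card_zmod]
  obtain ⟨t, ht⟩ := ((Nat.bijective_iff_injective_and_card F).2 ⟨hinj, hcard⟩).2 (⟨s, hs⟩, 0)
  exact ⟨t.1, t.2, congrFun (congrArg (fun y => y.1.1) ht)⟩

/-! ### Vertices of the Mermin polytopes -/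

section Vertices

variable {β : Ctx → ZMod 2} {u : Meas → ℝ}

theorem detSet_eq_univ_or_isHyperplane
    (hu : u ∈ (square.expectationPolytope β).extremePoints ℝ) :
    detSet u = Finset.univ ∨ square.IsHyperplane (detSet u) :=
  eq_univ_or_isHyperplane (Scenario.isClosed_detSet hu.1) (Scenario.card_le_of_mem_extremePoints hu)

theorem mem_extremePoints_iff_of_sum_eq_zero (hβ : ∑ C, β C = 0) :
    u ∈ (square.expectationPolytope β).extremePoints ℝ ↔
      ∃ t : {t // square.IsGlobal β t}, u = signVec Finset.univ fun m => t.1 m := by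
  constructor
  · intro hu
    have hs := Scenario.isOutcomeAssignment_detSet hu.1
    obtain huniv | hhyp := detSet_eq_univ_or_isHyperplane hu
    · rw [huniv] at hs
      refine ⟨⟨_, Scenario.IsOutcomeAssignment.isGlobal (t := fun m => signOf (u m)) hs⟩,
        funext fun m => ?_⟩
      rw [signVec_of_mem (Finset.mem_univ m),
        sgn_signOf (mem_detSet.1 (Finset.eq_univ_iff_forall.1 huniv m))]
    · exact absurd (isExtendable_of_sum_eq_zero hβ hhyp hs)
        (hhyp.not_isExtendable_of_mem_extremePoints hu)
  · rintro ⟨t, rfl⟩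
    exact t.2.signVec_mem_extremePoints

theorem maximal_isCnc_iff (hβ : ∑ C, β C = 1) {Ω : Finset Meas} :
    Maximal (square.IsCnc β) Ω ↔ square.IsType1 Ω ∨ square.IsType2 Ω := by
  have hglobal : ¬ ∃ t, square.IsGlobal β t := fun ⟨t, ht⟩ =>
    one_ne_zero (hβ.symm.trans (sum_eq_zero_of_isGlobal ht))
  have hmax {Ω : Finset Meas} (hΩ : square.IsHyperplane Ω) : Maximal (square.IsCnc β) Ω := by
    obtain ⟨⟨s, hs⟩⟩ : Nonempty {s : Ω → ZMod 2 // square.IsOutcomeAssignment β Ω s} :=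
      (Nat.card_pos_iff.1 (by rw [card_isOutcomeAssignment hΩ]; norm_num)).1
    exact hΩ.maximal_isCnc ⟨s, hs⟩ hglobal
  constructor
  · intro hΩ
    have hne : Ω ≠ Finset.univ := by
      rintro rfl
      obtain ⟨s, hs⟩ := hΩ.prop.2
      exact hglobal ⟨fun m => s ⟨m, Finset.mem_univ m⟩, hs.isGlobal⟩
    obtain ⟨Ω', htype, hΩ', hle⟩ := exists_subset_isHyperplane hΩ.prop.1 hne
    rwa [hΩ.eq_of_le (hmax hΩ').prop hle]
  · exact fun h => hmax (isHyperplane_iff.2 h)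

theorem mem_extremePoints_iff_of_sum_eq_one (hβ : ∑ C, β C = 1) :
    u ∈ (square.expectationPolytope β).extremePoints ℝ ↔
      ∃ x : square.CncPair β, u = signVec x.1.1 x.1.2 := by
  have hglobal {t : Meas → ZMod 2} : ¬ square.IsGlobal β t := fun ht =>
    one_ne_zero (hβ.symm.trans (sum_eq_zero_of_isGlobal ht))
  have hmax {Ω : Finset Meas} : Maximal (square.IsCnc β) Ω ↔ square.IsHyperplane Ω :=
    (maximal_isCnc_iff hβ).trans isHyperplane_iff.symm
  constructor
  · intro hu
    have hs := Scenario.isOutcomeAssignment_detSet hu.1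
    obtain huniv | hhyp := detSet_eq_univ_or_isHyperplane hu
    · rw [huniv] at hs
      exact absurd (Scenario.IsOutcomeAssignment.isGlobal (t := fun m => signOf (u m)) hs) hglobal
    · exact ⟨⟨⟨_, _⟩, hmax.2 hhyp, hs⟩, hhyp.eq_signVec_of_mem_extremePoints hu⟩
  · rintro ⟨x, rfl⟩
    exact (hmax.1 x.2.1).signVec_mem_extremePoints x.2.2 fun ⟨t, ht, _⟩ => hglobal ht

end Vertices

/-! ### Enumeration of the vertices -/

section Enumeration

variable {β : Ctx → ZMod 2}

theorem exists_equiv_vertices {X : Type*} {f : X → (Ω : Finset Meas) × (Ω → ZMod 2)}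
    (hf : Function.Injective f)
    (hext : ∀ u, u ∈ (square.expectationPolytope β).extremePoints ℝ ↔
      ∃ x, u = signVec (f x).1 (f x).2) :
    ∃ e : X ≃ vertices β,
      (∀ x, (e x).1 = square.ofExpectation β (signVec (f x).1 (f x).2)) ∧
        ∀ x, ∀ p ∈ MP β, square.HasMarginals p (f x).1 (f x).2 ↔ p = (e x).1 := by
  obtain ⟨e, he⟩ := Scenario.exists_equiv_extremePoints hf hext
  exact ⟨e, he, fun x p hp => he x ▸ Scenario.hasMarginals_iff hp⟩

theorem exists_equiv_vertices_of_sum_eq_zero (hβ : ∑ C, β C = 0) :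
    ∃ e : {t // square.IsGlobal β t} ≃ vertices β, ∀ t,
      (∀ p ∈ MP β, square.HasMarginals p Finset.univ (fun m => t.1 m) ↔ p = (e t).1) ∧
        ∀ C, (e t).1 C = Pi.single (fun m : square.context C => t.1 m) (1 : ℝ) := by
  let f (t : {t // square.IsGlobal β t}) : (Ω : Finset Meas) × (Ω → ZMod 2) :=
    ⟨Finset.univ, fun m => t.1 m⟩
  have hf : Function.Injective f := fun t t' h => Subtype.ext <| funext fun m =>
    congrFun (eq_of_heq (Sigma.mk.inj h).2) ⟨m, Finset.mem_univ m⟩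
  obtain ⟨e, he, hmarginals⟩ :=
    exists_equiv_vertices hf fun _ => mem_extremePoints_iff_of_sum_eq_zero hβ
  refine ⟨e, fun t => ⟨hmarginals t, fun C => ?_⟩⟩
  rw [he, Scenario.ofExpectation_signVec_univ t.2]

theorem ncard_vertices_of_sum_eq_zero (hβ : ∑ C, β C = 0) : (vertices β).ncard = 16 := by
  obtain ⟨e, -⟩ := exists_equiv_vertices_of_sum_eq_zero hβ
  rw [← Nat.card_coe_set_eq, ← Nat.card_congr e, card_isGlobal hβ]

theorem exists_equiv_vertices_of_sum_eq_one (hβ : ∑ C, β C = 1) :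
    ∃ e : square.CncPair β ≃ vertices β,
      ∀ x, ∀ p ∈ MP β, square.HasMarginals p x.1.1 x.1.2 ↔ p = (e x).1 :=
  let ⟨e, _, hmarginals⟩ := exists_equiv_vertices Subtype.val_injective
    fun _ => mem_extremePoints_iff_of_sum_eq_one hβ
  ⟨e, hmarginals⟩

theorem ncard_cncPair_of_isHyperplane (hβ : ∑ C, β C = 1) {P : Finset Meas → Prop}
    (hP : ∀ Ω, P Ω → square.IsHyperplane Ω) :
    {x : square.CncPair β | P x.1.1}.ncard = {Ω | P Ω}.ncard * 8 :=
  Scenario.ncard_cncPair (fun Ω hΩ => (maximal_isCnc_iff hβ).2 (isHyperplane_iff.1 (hP Ω hΩ)))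
    fun Ω hΩ => card_isOutcomeAssignment (hP Ω hΩ)

theorem ncard_cncPair_isType1 (hβ : ∑ C, β C = 1) :
    {x : square.CncPair β | square.IsType1 x.1.1}.ncard = 48 := by
  rw [ncard_cncPair_of_isHyperplane hβ fun _ hΩ => isHyperplane_iff.2 (.inl hΩ), ncard_isType1]

theorem ncard_cncPair_isType2 (hβ : ∑ C, β C = 1) :
    {x : square.CncPair β | square.IsType2 x.1.1}.ncard = 72 := by
  rw [ncard_cncPair_of_isHyperplane hβ fun _ hΩ => isHyperplane_iff.2 (.inr hΩ), ncard_isType2]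

end Enumeration

end Mermin

theorem theorem1_general (β : Mermin.Ctx → ZMod 2) :
    (∑ C, β C = 0 →
      (∃ e : {s : Mermin.Meas → ZMod 2 // Mermin.square.IsGlobal β s} ≃ Mermin.vertices β,
        ∀ s,
          (∀ p ∈ Mermin.MP β,
            Mermin.square.HasMarginals p Finset.univ (fun m => s.1 m) ↔ p = (e s).1) ∧
          (∀ C, (e s).1 C = Pi.single (fun m : Mermin.square.context C => s.1 m) (1 : ℝ))) ∧
      Function.Bijective (fun (s : {s : Mermin.Meas → ZMod 2 // Mermin.square.IsGlobal β s}) =>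
        fun m : Mermin.corner => s.1 m) ∧
      (Mermin.vertices β).ncard = 16) ∧
    (∑ C, β C = 1 →
      (∀ Ω : Finset Mermin.Meas, Maximal (Mermin.square.IsCnc β) Ω ↔
        Mermin.square.IsType1 Ω ∨ Mermin.square.IsType2 Ω) ∧
      ∃ e : Mermin.square.CncPair β ≃ Mermin.vertices β,
        (∀ x, ∀ p ∈ Mermin.MP β,
          Mermin.square.HasMarginals p x.1.1 x.1.2 ↔ p = (e x).1) ∧
        (e '' {x | Mermin.square.IsType1 x.1.1}).ncard = 48 ∧
        (e '' {x | Mermin.square.IsType2 x.1.1}).ncard = 72) := by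
  refine ⟨fun hβ => ⟨Mermin.exists_equiv_vertices_of_sum_eq_zero hβ,
    Mermin.bijective_restrict_corner hβ, Mermin.ncard_vertices_of_sum_eq_zero hβ⟩,
    fun hβ => ⟨fun _ => Mermin.maximal_isCnc_iff hβ, ?_⟩⟩
  obtain ⟨e, he⟩ := Mermin.exists_equiv_vertices_of_sum_eq_one hβ
  refine ⟨e, he, ?_, ?_⟩
  · rw [Set.ncard_image_of_injective _ e.injective, Mermin.ncard_cncPair_isType1 hβ]
  · rw [Set.ncard_image_of_injective _ e.injective, Mermin.ncard_cncPair_isType2 hβ]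

theorem theorem1 :
    -- the even case
    ((∃ e : {s : Mermin.Meas → ZMod 2 // Mermin.IsHom s} ≃ Mermin.vertices Mermin.β₀,
        ∀ s,
          (∀ p ∈ Mermin.MP Mermin.β₀,
            Mermin.square.HasMarginals p Finset.univ (fun m => s.1 m) ↔ p = (e s).1) ∧
          (∀ C, (e s).1 C = Pi.single (fun m : Mermin.square.context C => s.1 m) (1 : ℝ))) ∧
      Function.Bijective (fun (s : {s : Mermin.Meas → ZMod 2 // Mermin.IsHom s}) =>
        fun m : Mermin.corner => s.1 m) ∧
      (Mermin.vertices Mermin.β₀).ncard = 16) ∧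
    -- the odd case
    ((∀ Ω : Finset Mermin.Meas, Maximal (Mermin.square.IsCnc Mermin.β₁) Ω ↔
        Mermin.square.IsType1 Ω ∨ Mermin.square.IsType2 Ω) ∧
      ∃ e : Mermin.square.CncPair Mermin.β₁ ≃ Mermin.vertices Mermin.β₁,
        (∀ x, ∀ p ∈ Mermin.MP Mermin.β₁,
          Mermin.square.HasMarginals p x.1.1 x.1.2 ↔ p = (e x).1) ∧
        (e '' {x | Mermin.square.IsType1 x.1.1}).ncard = 48 ∧
        (e '' {x | Mermin.square.IsType2 x.1.1}).ncard = 72) := by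
  rw [show Mermin.IsHom = Mermin.square.IsGlobal Mermin.β₀ from funext fun _ =>
    propext Mermin.isHom_iff]
  exact ⟨(theorem1_general _).1 (by decide), (theorem1_general _).2 (by decide)⟩
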